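/- **Corollary (Lower bound of accumulative interference).** Let $\Phi=\{x_i\}$ be a homogeneous Poisson point process on $\mathbb{R}^2$ with intensity $\lambda>0$, and let the channel gains $h_i$ be i.i.d. copies of a random variable $h$ with $h>0$ almost surely and $\bar h_{2/\alpha}:=E[h^{2/\alpha}]<\infty$, independent of $\Phi$, where $\alpha>2$. For a receiver at $x\in\mathbb{R}^2$ with reception angle $\phi\in(0,2\pi]$, let $z_1<z_2<\cdots$ be the ascending enumeration of the points $\|x_i-x\|^{\alpha}/h_i$ over all nodes $x_i$ such that the angle in $[0,2\pi)$ of the vector $x_i-x$ with respect to the horizontal axis is at most $\phi$, and let $\mathcal{I}(n)=\sum_{k=n+1}^{\infty}z_k^{-1}$. For $b>0$ and $a\in\mathbb{R}\setminus\{0,-1,-2,\dots\}$ let $\gamma(a,b)=\Gamma(a)-\int_b^\infty t^{a-1}e^{-t}\,dt$ be the (analytically continued) lower incomplete gamma function. Then for every integer $n\ge 1$ and every $s>0$ the series $\mathcal{I}(n)$ converges almost surely, $\gamma(-2/\alpha,s/z_n)$ is integrable, and the unconditional Laplace transform of $\mathcal{I}(n)$ satisfies $$E\left[e^{-s\,\mathcal{I}(n)}\right]\;\ge\;\exp\left\{n+\frac{\phi\lambda\,\bar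 h_{2/\alpha}\,s^{2/\alpha}}{\alpha}\,E_{z_n}\!\left[\gamma\!\left(-\tfrac{2}{\alpha},\tfrac{s}{z_n}\right)\right]\right\},$$ where $$E_{z_n}\!\left[\gamma\!\left(-\tfrac2\alpha,\tfrac s{z_n}\right)\right]=\int_0^\infty\gamma\!\left(-\tfrac2\alpha,\tfrac sz\right)f^{\phi}_{z_n}(z)\,dz,\qquad f^{\phi}_{z_n}(z)=\frac{2\,e^{-\frac12\bar h_{2/\alpha}\phi\lambda z^{2/\alpha}}\left(\frac12\bar h_{2/\alpha}\phi\lambda z^{2/\alpha}\right)^n}{\alpha z\,(n-1)!}.$$ -/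

import Mathlib

open MeasureTheory ProbabilityTheory Set
open scoped ENNReal

noncomputable section

/-- The plane `ℝ²` with the Euclidean norm and Lebesgue measure. -/
abbrev Plane : Type := EuclideanSpace ℝ (Fin 2)

/-- Number of indices `i` with `X i ω ∈ B`, i.e. the mass that the point configuration
`∑ i, δ_(X i ω)` gives to `B` (possibly infinite). -/
def pointCount {Ω E : Type*} (X : ℕ → Ω → E) (B : Set E) (ω : Ω) : ℕ∞ :=
  {i : ℕ | X i ω ∈ B}.encard

/-- The random points `X 0, X 1, …` enumerate a Poisson point process with intensity measure `Λ`: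
the number of points in a measurable set `B` of finite intensity is Poisson with mean `Λ B`, and
the numbers of points in pairwise disjoint measurable sets are independent. -/
structure IsPoissonProcess {Ω E : Type*} [MeasurableSpace Ω] [MeasurableSpace E]
    (P : Measure Ω) (X : ℕ → Ω → E) (Λ : Measure E) : Prop where
  measurable : ∀ i, Measurable (X i)
  poisson : ∀ B : Set E, MeasurableSet B → Λ B ≠ ∞ →
    HasLaw (pointCount X B) ((poissonMeasure (Λ B).toNNReal).map (Nat.cast : ℕ → ℕ∞)) P
  indep : ∀ (m : ℕ) (B : Fin m → Set E), (∀ j, MeasurableSet (B j)) →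
    Pairwise (fun i j => Disjoint (B i) (B j)) →
    iIndepFun (fun j => pointCount X (B j)) P

/-- Poisson network with intensity `lam` on the plane and i.i.d. channel gains of law `ν`:
`X i` is the position of node `i`, `h i` its channel gain, and the gains are independent of the
positions. -/
structure IsPoissonNetwork {Ω : Type*} [MeasurableSpace Ω] (P : Measure Ω)
    (lam : ℝ) (ν : Measure ℝ) (X : ℕ → Ω → Plane) (h : ℕ → Ω → ℝ) : Prop where
  nodes : IsPoissonProcess P X (ENNReal.ofReal lam • (volume : Measure Plane))
  gain_measurable : ∀ i, Measurable (h i)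
  gain_law : ∀ i, HasLaw (h i) ν P
  gain_indep : iIndepFun h P
  gains_indep_nodes : IndepFun (fun ω i => X i ω) (fun ω i => h i ω) P

/-- Angle in `[0, 2π)` of a vector of the plane, counted counterclockwise from the positive
horizontal axis. -/
def polarAngle (v : Plane) : ℝ :=
  if 0 ≤ Complex.arg ⟨v 0, v 1⟩ then Complex.arg ⟨v 0, v 1⟩
  else Complex.arg ⟨v 0, v 1⟩ + 2 * Real.pi

/-- Inverse received power `‖X i - x‖ ^ α / h i` of node `i` at the receiver `x`. -/
def invPower {Ω : Type*} (α : ℝ) (x : Plane) (X : ℕ → Ω → Plane) (h : ℕ → Ω → ℝ)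
    (i : ℕ) (ω : Ω) : ℝ :=
  ‖X i ω - x‖ ^ α / h i ω

/-- For `n ≥ 1`, the `n`-th smallest among the inverse received powers of the nodes that the
receiver at `x` sees within its reception angle `φ` (the smallest `t` such that at least `n` such
nodes have inverse power `≤ t`). Its inverse is the `n`-th dominant interference power. -/
def nthInvPower {Ω : Type*} (α φ : ℝ) (x : Plane) (X : ℕ → Ω → Plane) (h : ℕ → Ω → ℝ)
    (n : ℕ) (ω : Ω) : ℝ :=
  sInf {t : ℝ | (n : ℕ∞) ≤
    {i : ℕ | polarAngle (X i ω - x) ≤ φ ∧ invPower α x X h i ω ≤ t}.encard}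

/-- Partial accumulative interference `𝓘(n) = ∑_{k ≥ n + 1} z_k⁻¹`. -/
def partialInterference {Ω : Type*} (α φ : ℝ) (x : Plane) (X : ℕ → Ω → Plane) (h : ℕ → Ω → ℝ)
    (n : ℕ) (ω : Ω) : ℝ :=
  ∑' k : ℕ, (nthInvPower α φ x X h (n + 1 + k) ω)⁻¹

/-- Lower incomplete gamma function `γ(a, b)` for `b > 0` and real `a ∉ {0, -1, -2, …}`: the
analytic continuation in `a` of `∫₀ᵇ t ^ (a - 1) e ^ (-t) dt`, which converges only for `a > 0`,
written as `Γ(a) - Γ(a, b)` with the upper incomplete gamma function. -/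
def lowerGamma (a b : ℝ) : ℝ :=
  Real.Gamma a - ∫ t in Ioi b, t ^ (a - 1) * Real.exp (-t)

/-- For `a > 0` this is the usual integral. -/
theorem lowerGamma_of_pos {a b : ℝ} (ha : 0 < a) (hb : 0 ≤ b) :
    lowerGamma a b = ∫ t in Ioc 0 b, t ^ (a - 1) * Real.exp (-t) := by
  have hi : IntegrableOn (fun t : ℝ => t ^ (a - 1) * Real.exp (-t)) (Ioi 0) := by
    simpa only [mul_comm] using Real.GammaIntegral_convergent ha
  have hG : Real.Gamma a = ∫ t in Ioi 0, t ^ (a - 1) * Real.exp (-t) := by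
    rw [Real.Gamma_eq_integral ha]
    simp only [mul_comm]
  have hu : Ioc (0 : ℝ) b ∪ Ioi b = Ioi 0 := Ioc_union_Ioi_eq_Ioi hb
  have hs : (∫ t in Ioi (0 : ℝ), t ^ (a - 1) * Real.exp (-t)) =
      (∫ t in Ioc 0 b, t ^ (a - 1) * Real.exp (-t)) +
        ∫ t in Ioi b, t ^ (a - 1) * Real.exp (-t) := by
    rw [← hu]
    refine setIntegral_union ?_ measurableSet_Ioi ?_ ?_
    · exact Set.disjoint_left.2 fun t h1 h2 => not_lt.2 h1.2 h2
    · exact hi.mono_set Ioc_subset_Ioi_self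
    · exact hi.mono_set (Ioi_subset_Ioi hb)
  rw [lowerGamma, hG, hs]
  ring

/-- `E[h ^ (2 / α)]` for a channel gain `h` of law `ν`. -/
def gainMoment (α : ℝ) (ν : Measure ℝ) : ℝ :=
  ∫ t, t ^ (2 / α) ∂ν

/-- The probability density of the `n`-th smallest inverse power, at `z > 0`. -/
def invPowerPDF (lam α φ : ℝ) (ν : Measure ℝ) (n : ℕ) (z : ℝ) : ℝ :=
  2 * Real.exp (-(1 / 2 * gainMoment α ν * φ * lam * z ^ (2 / α))) *
    (1 / 2 * gainMoment α ν * φ * lam * z ^ (2 / α)) ^ n / (α * z * ((n - 1).factorial : ℝ))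

end

/-! Put δ = 2/α, so 0 < δ < 1, and c = ½·E[h^δ]·φ·λ. Independent marking and mapping preserve the
Poisson property, so the inverse powers of the visible nodes are a Poisson process on the half line
(`IsPoissonNetwork.isPoissonRandomMeasure`). The area of a sector shows that (0, z] has intensity
c·z^δ (`map_markInvPower_eq`). Given z_n = z, the points beyond z are still Poisson, so the
conditional Laplace transform of the remaining interference is the exponential of -∫_z^∞ (1 -
e^{-s/y}) c δ y^{δ-1} dy. This exponent equals c·z^δ + c·δ·s^δ·γ(-δ, s/z)
(`setLIntegral_one_sub_expNeg`). Jensen's inequality moves the mean over z_n into the exponent.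
Since c·z_n^δ has the Gamma law of shape n, its mean n is the first term of the bound
(`integral_mul_rpow_nthPointLaw`). Conditioning on z_n is avoided, because only a lower bound is
needed. On a fine grid, the events "n - 1 points up to the left end of a cell, one point in the
cell" are disjoint, and on each of them the remaining interference depends only on the points beyond
the cell. Summing over the cells (`IsPoissonRandomMeasure.lintegral_gridApprox_le`) and applying
Fatou's lemma gives the mean of the conditional transform as a lower bound. The independence used
here is read off the Laplace functional by comparing generating functions
(`IsPoissonRandomMeasure.setLIntegral_counts`). Sums and integrals stay in [0, ∞] with exp(-∞) = 0,
so almost sure convergence is a consequence of the Laplace functional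
(`IsPoissonRandomMeasure.ae_lintegral_inv_ne_top`) and not a prerequisite. -/

/-! ### The extended exponential and the Laplace transform of the Poisson law. -/

/-- The function `a ↦ exp (-a)` on `[0, ∞]`, with `exp (-∞) = 0`. -/
noncomputable def expNeg (a : ℝ≥0∞) : ℝ≥0∞ := EReal.exp (-(a : EReal))

lemma expNeg_zero : expNeg 0 = 1 := by simp [expNeg]

lemma expNeg_top : expNeg ∞ = 0 := by simp [expNeg]

lemma expNeg_add (a b : ℝ≥0∞) : expNeg (a + b) = expNeg a * expNeg b := by
  rw [expNeg, expNeg, expNeg, ← EReal.exp_add, EReal.coe_ennreal_add, EReal.neg_add, sub_eq_add_neg]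
  · left; exact EReal.coe_ennreal_ne_bot a
  · right; exact EReal.coe_ennreal_ne_bot b

lemma expNeg_ofReal {a : ℝ} (ha : 0 ≤ a) :
    expNeg (ENNReal.ofReal a) = ENNReal.ofReal (Real.exp (-a)) := by
  rw [expNeg, EReal.coe_ennreal_ofReal, max_eq_left ha, ← EReal.coe_neg, EReal.exp_coe]

lemma continuous_expNeg : Continuous expNeg :=
  ENNReal.continuous_exp.comp (continuous_neg.comp continuous_coe_ennreal_ereal)

lemma measurable_expNeg : Measurable expNeg := continuous_expNeg.measurable

lemma antitone_expNeg : Antitone expNeg := fun a b h => by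
  unfold expNeg
  exact EReal.exp_monotone (EReal.neg_le_neg_iff.2 (EReal.coe_ennreal_le_coe_ennreal_iff.2 h))

lemma expNeg_le_one (a : ℝ≥0∞) : expNeg a ≤ 1 := by
  rw [← expNeg_zero]; exact antitone_expNeg zero_le

lemma expNeg_ne_top (a : ℝ≥0∞) : expNeg a ≠ ∞ :=
  ((expNeg_le_one a).trans_lt ENNReal.one_lt_top).ne

lemma expNeg_sum {ι : Type*} (s : Finset ι) (f : ι → ℝ≥0∞) :
    expNeg (∑ i ∈ s, f i) = ∏ i ∈ s, expNeg (f i) := by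
  classical
  induction s using Finset.induction_on with
  | empty => simp [expNeg_zero]
  | insert a s ha ih => rw [Finset.sum_insert ha, Finset.prod_insert ha, expNeg_add, ih]

/-- Lets a mark average with values in [0, 1] be written as the exponential of a test function of
the position alone; g = 0 is allowed and corresponds to the value ∞. -/
lemma expNeg_toENNReal_neg_log {g : ℝ≥0∞} (hg : g ≤ 1) :
    expNeg (-ENNReal.log g).toENNReal = g := by
  rw [expNeg, EReal.coe_toENNReal, neg_neg, ENNReal.exp_log]
  rw [EReal.neg_nonneg]
  exact ENNReal.log_le_zero_iff.2 hg

lemma expNeg_ne_zero {a : ℝ≥0∞} (ha : a ≠ ∞) : expNeg a ≠ 0 := by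
  simp [expNeg, ha]

lemma expNeg_mul_one_sub {m : ℝ} (hm : 0 ≤ m) {a : ℝ} (ha : 0 ≤ a) :
    expNeg (ENNReal.ofReal m * (1 - expNeg (ENNReal.ofReal a))) =
      ENNReal.ofReal (Real.exp (-(m * (1 - Real.exp (-a))))) := by
  rw [expNeg_ofReal ha, ← ENNReal.ofReal_one, ← ENNReal.ofReal_sub _ (Real.exp_pos _).le,
    ← ENNReal.ofReal_mul hm, expNeg_ofReal]
  exact mul_nonneg hm (sub_nonneg.2 (Real.exp_le_one_iff.2 (by linarith)))

lemma lintegral_expNeg_poissonMeasure (m : NNReal) {r : ℝ≥0∞} (hr : r ≠ ∞) :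
    ∫⁻ k, expNeg (r * (k : ℝ≥0∞)) ∂(poissonMeasure m) = expNeg (m * (1 - expNeg r)) := by
  obtain ⟨a, ha, rfl⟩ : ∃ a : ℝ, 0 ≤ a ∧ r = ENNReal.ofReal a :=
    ⟨r.toReal, ENNReal.toReal_nonneg, (ENNReal.ofReal_toReal hr).symm⟩
  have hs : HasSum (fun k : ℕ => Real.exp (-(m : ℝ)) * (((m : ℝ) * Real.exp (-a)) ^ k / k.factorial))
      (Real.exp (-(m : ℝ)) * Real.exp ((m : ℝ) * Real.exp (-a))) := by
    -- Exponential tilting: the Poisson weights of mean m·e^{-a} sum to one, and e^{m e^{-a}}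
    -- cancels their normalization.
    have h0 := (hasSum_one_poissonMeasure (m * (Real.exp (-a)).toNNReal)).mul_left
      (Real.exp ((m : ℝ) * Real.exp (-a)))
    rw [mul_one] at h0
    refine HasSum.mul_left _ (h0.congr_fun fun k => ?_)
    rw [NNReal.coe_mul, Real.coe_toNNReal _ (Real.exp_pos _).le, mul_div_assoc, ← mul_assoc, ← Real.exp_add, add_neg_cancel, Real.exp_zero, one_mul]
  have hm : (m : ℝ≥0∞) = ENNReal.ofReal (m : ℝ) := by simp
  rw [hm, expNeg_mul_one_sub m.coe_nonneg ha, lintegral_countable']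
  have h1 : ∀ k : ℕ, expNeg (ENNReal.ofReal a * (k : ℝ≥0∞)) * (poissonMeasure m) {k} =
      ENNReal.ofReal (Real.exp (-(m : ℝ)) * (((m : ℝ) * Real.exp (-a)) ^ k / k.factorial)) := by
    intro k
    rw [poissonMeasure_singleton, ← ENNReal.ofReal_natCast k, ← ENNReal.ofReal_mul ha,
      expNeg_ofReal (by positivity), ← ENNReal.ofReal_mul (Real.exp_pos _).le]
    congr 1
    have : Real.exp (-(a * k)) = Real.exp (-a) ^ k := by
      rw [← Real.exp_nat_mul]; congr 1; ring
    rw [this, mul_pow]; ring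
  simp_rw [h1]
  rw [← ENNReal.ofReal_tsum_of_nonneg (fun k => by positivity) hs.summable, hs.tsum_eq,
    ← Real.exp_add]
  congr 2; ring

lemma tsum_indicator_preimage {Ω E : Type*} (X : ℕ → Ω → E) (B : Set E) (ω : Ω) (r : ℝ≥0∞) :
    ∑' i, B.indicator (fun _ => r) (X i ω) = r * (pointCount X B ω : ℝ≥0∞) := by
  rw [pointCount, mul_comm, ← ENNReal.tsum_set_const,
    tsum_subtype _ (fun _ => r)]
  rfl

/-! ### Laplace functional of an unmarked Poisson process. -/

section PoissonProcess

variable {Ω E : Type*} [MeasurableSpace Ω] [MeasurableSpace E] {P : Measure Ω}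
  {X : ℕ → Ω → E} {Λ : Measure E}

lemma IsPoissonProcess.lintegral_expNeg_pointCount (hX : IsPoissonProcess P X Λ) {B : Set E}
    (hB : MeasurableSet B) (hΛ : Λ B ≠ ∞) {r : ℝ≥0∞} (hr : r ≠ ∞) :
    ∫⁻ ω, expNeg (r * (pointCount X B ω : ℝ≥0∞)) ∂P = expNeg (Λ B * (1 - expNeg r)) := by
  have hm : Measurable fun k : ℕ∞ => expNeg (r * (k : ℝ≥0∞)) := by
    exact measurable_expNeg.comp (Measurable.of_discrete)
  rw [(hX.poisson B hB hΛ).lintegral_comp (f := fun k : ℕ∞ => expNeg (r * (k : ℝ≥0∞)))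
    hm.aemeasurable, lintegral_map hm .of_discrete]
  simp only [ENat.toENNReal_coe]
  rw [lintegral_expNeg_poissonMeasure _ hr, ENNReal.coe_toNNReal hΛ]

lemma IsPoissonProcess.measurable_pointCount (hX : IsPoissonProcess P X Λ) {B : Set E}
    (hB : MeasurableSet B) : Measurable fun ω => (pointCount X B ω : ℝ≥0∞) := by
  have : ∀ ω, (pointCount X B ω : ℝ≥0∞) = ∑' i, B.indicator (fun _ => 1) (X i ω) := by
    intro ω; rw [tsum_indicator_preimage X, one_mul]
  simp_rw [this]
  exact Measurable.tsum fun i => (measurable_const.indicator hB).comp (hX.measurable i)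

/-- Laplace functional of a Poisson process on simple functions. -/
lemma IsPoissonProcess.laplace_simpleFunc (hX : IsPoissonProcess P X Λ) (v : SimpleFunc E ℝ≥0∞)
    (hv : ∀ r ∈ v.range, r ≠ ∞) (hΛ : ∀ r ∈ v.range, r ≠ 0 → Λ (v ⁻¹' {r}) ≠ ∞) :
    ∫⁻ ω, expNeg (∑' i, v (X i ω)) ∂P = expNeg (∫⁻ y, (1 - expNeg (v y)) ∂Λ) := by
  classical
  have hcount : ∀ ω, ∑' i, v (X i ω) = ∑ r ∈ v.range, r * (pointCount X (v ⁻¹' {r}) ω : ℝ≥0∞) := by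
    intro ω
    simp_rw [← tsum_indicator_preimage]
    rw [← Summable.tsum_finsetSum (fun _ _ => ENNReal.summable)]
    refine tsum_congr fun i => ?_
    rw [Finset.sum_eq_single (v (X i ω))]
    · simp
    · intro r _ hr
      rw [indicator_of_notMem]
      simpa using fun h => hr h.symm
    · intro h; exact absurd (v.mem_range_self _) h
  -- Level sets of a simple function are pairwise disjoint, so their counts are independent.
  have hind : iIndepFun (fun (r : v.range) ω => pointCount X (v ⁻¹' {r.1}) ω) P := by
    have e := v.range.equivFin
    have h1 := hX.indep v.range.card (fun j => v ⁻¹' {(e.symm j).1})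
      (fun j => v.measurableSet_preimage _) (fun i j hij => by
        refine Disjoint.preimage _ ?_
        simpa using fun h => hij (e.symm.injective (Subtype.ext h)))
    have h2 := h1.precomp e.injective
    simpa using h2
  have hind2 : iIndepFun
      (fun (r : v.range) ω => expNeg (r.1 * (pointCount X (v ⁻¹' {r.1}) ω : ℝ≥0∞))) P :=
    hind.comp (fun r k => expNeg (r.1 * (k : ℝ≥0∞)))
      (fun r => measurable_expNeg.comp Measurable.of_discrete)
  simp_rw [hcount, expNeg_sum]
  simp_rw [← Finset.prod_coe_sort v.range]
  rw [lintegral_prod_eq_prod_lintegral_of_indepFun _ _ hind2 (fun r => measurable_expNeg.comp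
    ((hX.measurable_pointCount (v.measurableSet_preimage _)).const_mul _))]
  have h3 : ∀ r : v.range, ∫⁻ ω, expNeg (r.1 * (pointCount X (v ⁻¹' {r.1}) ω : ℝ≥0∞)) ∂P =
      expNeg ((1 - expNeg r.1) * Λ (v ⁻¹' {r.1})) := by
    intro r
    -- The level set of the value 0 may have infinite intensity, but it contributes the factor 1 on
    -- both sides.
    by_cases h0 : r.1 = 0
    · have := hind.isProbabilityMeasure
      simp [h0, expNeg_zero]
    · rw [hX.lintegral_expNeg_pointCount (v.measurableSet_preimage _) (hΛ _ r.2 h0) (hv _ r.2),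
        mul_comm]
  simp_rw [h3]
  rw [Finset.prod_coe_sort v.range (fun r => expNeg ((1 - expNeg r) * Λ (v ⁻¹' {r}))),
    ← expNeg_sum]
  congr 1
  have h4 := SimpleFunc.map_lintegral (μ := Λ) (fun r => 1 - expNeg r) v
  rw [← h4, ← SimpleFunc.lintegral_eq_lintegral]
  rfl

/-- Laplace functional of a Poisson process. -/
theorem IsPoissonProcess.laplace [SigmaFinite Λ] (hX : IsPoissonProcess P X Λ) {v : E → ℝ≥0∞}
    (hv : Measurable v) :
    ∫⁻ ω, expNeg (∑' i, v (X i ω)) ∂P = expNeg (∫⁻ y, (1 - expNeg (v y)) ∂Λ) := by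
  -- Independence of the empty family already forces total mass one.
  have hP : IsProbabilityMeasure P := (hX.indep 0 (fun _ => ∅) (by simp) (fun i => i.elim0)).isProbabilityMeasure
  -- Cutting off to the k-th spanning set makes every nonzero level set have finite intensity, while
  -- the functions still increase to `v`.
  let u : ℕ → SimpleFunc E ℝ≥0∞ := fun k =>
    (SimpleFunc.eapprox v k).restrict (spanningSets Λ k)
  have hu : ∀ k y, u k y = (spanningSets Λ k).indicator (SimpleFunc.eapprox v k) y := fun k y =>
    SimpleFunc.restrict_apply _ (measurableSet_spanningSets Λ k) y
  have hmono : ∀ y, Monotone fun k => u k y := by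
    intro y k l hkl
    simp only [hu]
    refine (indicator_le_indicator_of_subset (monotone_spanningSets Λ hkl) (fun _ => zero_le)
      y).trans (indicator_le_indicator (SimpleFunc.monotone_eapprox v hkl y))
  have hsup : ∀ y, ⨆ k, u k y = v y := by
    intro y
    apply le_antisymm
    · refine iSup_le fun k => ?_
      rw [hu]
      refine (indicator_le_self _ _ y).trans ?_
      rw [← SimpleFunc.iSup_eapprox_apply hv y]
      exact le_iSup (fun k => SimpleFunc.eapprox v k y) k
    · rw [← SimpleFunc.iSup_eapprox_apply hv y]
      obtain ⟨k0, hk0⟩ : ∃ k, y ∈ spanningSets Λ k := by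
        have : y ∈ ⋃ k, spanningSets Λ k := by rw [iUnion_spanningSets]; trivial
        exact mem_iUnion.1 this
      refine iSup_le fun k => ?_
      refine le_trans ?_ (le_iSup _ (max k k0))
      rw [hu, indicator_of_mem (monotone_spanningSets Λ (le_max_right k k0) hk0)]
      exact SimpleFunc.monotone_eapprox v (le_max_left k k0) y
  have hlim : ∀ y, Filter.Tendsto (fun k => u k y) Filter.atTop (nhds (v y)) := fun y =>
    hsup y ▸ tendsto_atTop_iSup (hmono y)
  have hk : ∀ k, ∫⁻ ω, expNeg (∑' i, u k (X i ω)) ∂P = expNeg (∫⁻ y, (1 - expNeg (u k y)) ∂Λ) := by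
    intro k
    apply hX.laplace_simpleFunc
    · intro r hr
      obtain ⟨y, rfl⟩ := SimpleFunc.mem_range.1 hr
      rw [hu]
      exact ((indicator_le_self _ _ y).trans_lt (SimpleFunc.eapprox_lt_top v k y)).ne
    · intro r _ h0
      refine ((measure_mono fun y hy => ?_).trans_lt (measure_spanningSets_lt_top Λ k)).ne
      by_contra hn
      apply h0
      have : u k y = r := hy
      rw [← this, hu, indicator_of_notMem hn]
  have hL : Filter.Tendsto (fun k => ∫⁻ ω, expNeg (∑' i, u k (X i ω)) ∂P) Filter.atTop
      (nhds (∫⁻ ω, expNeg (∑' i, v (X i ω)) ∂P)) := by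
    refine tendsto_lintegral_of_dominated_convergence (fun _ => 1) (fun k => ?_) (fun k => ?_)
      (by simp) ?_
    · exact measurable_expNeg.comp (Measurable.tsum fun i =>
        (u k).measurable.comp (hX.measurable i))
    · exact Filter.Eventually.of_forall fun ω => expNeg_le_one _
    · refine Filter.Eventually.of_forall fun ω => (continuous_expNeg.tendsto _).comp ?_
      have h5 : ∑' i, v (X i ω) = ⨆ k, ∑' i, u k (X i ω) := by
        simp_rw [← hsup]
        simp_rw [← lintegral_count]
        exact lintegral_iSup (fun k => Measurable.of_discrete) (fun k l hkl i => hmono _ hkl)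
      rw [h5]
      exact tendsto_atTop_iSup fun k l hkl => ENNReal.tsum_le_tsum fun i => hmono _ hkl
  have hR : Filter.Tendsto (fun k => expNeg (∫⁻ y, (1 - expNeg (u k y)) ∂Λ)) Filter.atTop
      (nhds (expNeg (∫⁻ y, (1 - expNeg (v y)) ∂Λ))) := by
    refine (continuous_expNeg.tendsto _).comp (lintegral_tendsto_of_tendsto_of_monotone
      (fun k => (measurable_const.sub (measurable_expNeg.comp (u k).measurable)).aemeasurable)
      (Filter.Eventually.of_forall fun y k l hkl =>
        tsub_le_tsub_left (antitone_expNeg (hmono y hkl)) 1)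
      (Filter.Eventually.of_forall fun y => ?_))
    exact ENNReal.Tendsto.sub tendsto_const_nhds ((continuous_expNeg.tendsto _).comp (hlim y))
      (Or.inl ENNReal.one_ne_top)
  simp_rw [hk] at hL
  exact tendsto_nhds_unique hL hR

end PoissonProcess

/-! ### Independent marking. -/

section Marking

variable {Ω E F : Type*} [MeasurableSpace Ω] [MeasurableSpace E] [MeasurableSpace F]
  {P : Measure Ω} {X : ℕ → Ω → E} {h : ℕ → Ω → F} {ν : Measure F}

/-- Fubini for the product law of positions and marks: with the positions frozen, the factors depend
on different independent marks. Independence yields finite products only, hence the truncation at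
`k`. -/
lemma lintegral_expNeg_sum_marks [IsProbabilityMeasure P] [IsProbabilityMeasure ν]
    (hX : ∀ i, Measurable (X i))
    (hm : ∀ i, Measurable (h i)) (hlaw : ∀ i, HasLaw (h i) ν P) (hi : iIndepFun h P)
    (hXh : IndepFun (fun ω i => X i ω) (fun ω i => h i ω) P) {v : E × F → ℝ≥0∞}
    (hv : Measurable v) (k : ℕ) :
    ∫⁻ ω, expNeg (∑ i ∈ Finset.range k, v (X i ω, h i ω)) ∂P =
      ∫⁻ ω, ∏ i ∈ Finset.range k, ∫⁻ t, expNeg (v (X i ω, t)) ∂ν ∂P := by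
  have hXm : Measurable fun ω i => X i ω := measurable_pi_lambda _ hX
  have hhm : Measurable fun ω i => h i ω := measurable_pi_lambda _ hm
  have hev : Measurable fun p => expNeg (v p) := measurable_expNeg.comp hv
  let Φ : (ℕ → E) × (ℕ → F) → ℝ≥0∞ := fun p => ∏ i ∈ Finset.range k, expNeg (v (p.1 i, p.2 i))
  have hΦ : Measurable Φ := Finset.measurable_prod _ fun i _ =>
    hev.comp (((measurable_pi_apply i).comp measurable_fst).prodMk
      ((measurable_pi_apply i).comp measurable_snd))
  have hG : Measurable fun y => ∫⁻ t, expNeg (v (y, t)) ∂ν := hev.lintegral_prod_right'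
  calc ∫⁻ ω, expNeg (∑ i ∈ Finset.range k, v (X i ω, h i ω)) ∂P
      = ∫⁻ ω, Φ (fun i => X i ω, fun i => h i ω) ∂P := by simp_rw [expNeg_sum]; rfl
    _ = ∫⁻ p, Φ p ∂(P.map fun ω => (fun i => X i ω, fun i => h i ω)) :=
        (lintegral_map hΦ (hXm.prodMk hhm)).symm
    _ = ∫⁻ p, Φ p ∂((P.map fun ω i => X i ω).prod (P.map fun ω i => h i ω)) := by
        rw [(indepFun_iff_map_prod_eq_prod_map_map hXm.aemeasurable hhm.aemeasurable).1 hXh]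
    _ = ∫⁻ x, ∫⁻ t, Φ (x, t) ∂(P.map fun ω i => h i ω) ∂(P.map fun ω i => X i ω) := by
        have := Measure.isProbabilityMeasure_map (μ := P) hhm.aemeasurable
        exact lintegral_prod _ hΦ.aemeasurable
    _ = ∫⁻ x, ∏ i ∈ Finset.range k, ∫⁻ t, expNeg (v (x i, t)) ∂ν ∂(P.map fun ω i => X i ω) := by
        refine lintegral_congr fun x => ?_
        rw [lintegral_map (f := fun t => Φ (x, t)) (hΦ.comp measurable_prodMk_left) hhm]
        have h1 := lintegral_prod_eq_prod_lintegral_of_indepFun (μ := P) (Finset.range k)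
          (fun i ω => expNeg (v (x i, h i ω)))
          (hi.comp (fun i t => expNeg (v (x i, t))) fun i => hev.comp measurable_prodMk_left)
          (fun i => hev.comp (measurable_prodMk_left.comp (hm i)))
        refine h1.trans (Finset.prod_congr rfl fun i _ => ?_)
        exact (hlaw i).lintegral_comp (f := fun t => expNeg (v (x i, t)))
          (hev.comp measurable_prodMk_left).aemeasurable
    _ = _ := by
        rw [lintegral_map _ hXm]
        exact Finset.measurable_prod _ fun i _ => hG.comp (measurable_pi_apply i)

lemma tendsto_lintegral_expNeg_sum [IsFiniteMeasure P] {f : ℕ → Ω → ℝ≥0∞}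
    (hf : ∀ i, Measurable (f i)) :
    Filter.Tendsto (fun k => ∫⁻ ω, expNeg (∑ i ∈ Finset.range k, f i ω) ∂P) Filter.atTop
      (nhds (∫⁻ ω, expNeg (∑' i, f i ω) ∂P)) := by
  refine tendsto_lintegral_of_dominated_convergence (fun _ => 1) (fun k => ?_) (fun k => ?_)
    (by simp) ?_
  · exact measurable_expNeg.comp (Finset.measurable_sum _ fun i _ => hf i)
  · exact Filter.Eventually.of_forall fun ω => expNeg_le_one _
  · exact Filter.Eventually.of_forall fun ω =>
      (continuous_expNeg.tendsto _).comp (ENNReal.tendsto_nat_tsum _)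

/-- Laplace functional of a Poisson process with independent marks. -/
theorem IsPoissonProcess.laplace_marked [IsProbabilityMeasure P] [IsProbabilityMeasure ν]
    {Λ : Measure E} [SigmaFinite Λ] (hX : IsPoissonProcess P X Λ)
    (hm : ∀ i, Measurable (h i)) (hlaw : ∀ i, HasLaw (h i) ν P) (hi : iIndepFun h P)
    (hXh : IndepFun (fun ω i => X i ω) (fun ω i => h i ω) P) {v : E × F → ℝ≥0∞}
    (hv : Measurable v) :
    ∫⁻ ω, expNeg (∑' i, v (X i ω, h i ω)) ∂P =
      expNeg (∫⁻ p, (1 - expNeg (v p)) ∂(Λ.prod ν)) := by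
  have hev : Measurable fun p => expNeg (v p) := measurable_expNeg.comp hv
  have hG : Measurable fun y => ∫⁻ t, expNeg (v (y, t)) ∂ν := hev.lintegral_prod_right'
  have hG1 : ∀ y, ∫⁻ t, expNeg (v (y, t)) ∂ν ≤ 1 := fun y =>
    (lintegral_mono fun t => expNeg_le_one _).trans (by simp)
  -- V is chosen so that exp(-V(y)) is the mark average at y; the marked functional then becomes the
  -- unmarked one with test function V.
  let V : E → ℝ≥0∞ := fun y => (-ENNReal.log (∫⁻ t, expNeg (v (y, t)) ∂ν)).toENNReal
  have hVm : Measurable V := (hG.ennreal_log.neg).ereal_toENNReal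
  have hV : ∀ y, expNeg (V y) = ∫⁻ t, expNeg (v (y, t)) ∂ν := fun y =>
    expNeg_toENNReal_neg_log (hG1 y)
  have h1 := tendsto_lintegral_expNeg_sum (P := P) (f := fun i ω => v (X i ω, h i ω))
    fun i => hv.comp ((hX.measurable i).prodMk (hm i))
  have h2 := tendsto_lintegral_expNeg_sum (P := P) (f := fun i ω => V (X i ω))
    fun i => hVm.comp (hX.measurable i)
  simp_rw [lintegral_expNeg_sum_marks hX.measurable hm hlaw hi hXh hv] at h1
  simp_rw [expNeg_sum, hV] at h2
  rw [tendsto_nhds_unique h1 h2, hX.laplace hVm,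
    lintegral_prod (fun p => 1 - expNeg (v p)) (measurable_const.sub hev).aemeasurable]
  congr 1
  refine lintegral_congr fun y => ?_
  rw [hV, lintegral_sub (g := fun t => expNeg (v (y, t))) (hev.comp measurable_prodMk_left)
    ((hG1 y).trans_lt ENNReal.one_lt_top).ne (Filter.Eventually.of_forall fun t => expNeg_le_one _)]
  simp

end Marking

/-! ### The projected process of inverse powers on the line. -/

/-- A random measure on `ℝ` with values in `{0, 1, …, ∞}` whose Laplace functional is that of a
Poisson random measure with intensity measure `μ`. -/
structure IsPoissonRandomMeasure {Ω : Type*} [MeasurableSpace Ω] (P : Measure Ω)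
    (η : Ω → Measure ℝ) (μ : Measure ℝ) : Prop where
  measurable : Measurable η
  sFinite : ∀ ω, SFinite (η ω)
  integer : ∀ ω B, MeasurableSet B → ∃ k : ℕ∞, η ω B = k
  laplace : ∀ w : ℝ → ℝ≥0∞, Measurable w →
    ∫⁻ ω, expNeg (∫⁻ z, w z ∂(η ω)) ∂P = expNeg (∫⁻ z, (1 - expNeg (w z)) ∂μ)

section InversePower

lemma measurable_polarAngle : Measurable polarAngle := by
  have h1 : Measurable fun v : Plane => Complex.arg ⟨v 0, v 1⟩ := by
    have : Measurable fun v : Plane => Complex.measurableEquivRealProd.symm (v 0, v 1) :=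
      Complex.measurableEquivRealProd.symm.measurable.comp (by fun_prop)
    exact Complex.measurable_arg.comp this
  exact Measurable.ite (measurableSet_le measurable_const h1) h1 (h1.add_const _)

/-- Marked positions `(y, t)` that the receiver at `x` sees within its reception angle `φ`. -/
def visible (φ : ℝ) (x : Plane) : Set (Plane × ℝ) := {p | polarAngle (p.1 - x) ≤ φ}

lemma measurableSet_visible (φ : ℝ) (x : Plane) : MeasurableSet (visible φ x) :=
  measurableSet_le (measurable_polarAngle.comp (measurable_fst.sub_const x)) measurable_const

/-- The inverse received power as a function of the marked position. -/
noncomputable def markInvPower (α : ℝ) (x : Plane) (p : Plane × ℝ) : ℝ := ‖p.1 - x‖ ^ α / p.2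

lemma measurable_markInvPower (α : ℝ) (x : Plane) : Measurable (markInvPower α x) := by
  unfold markInvPower
  fun_prop

/-- The point configuration of the inverse received powers of the visible nodes. -/
noncomputable def invPowerMeasure {Ω : Type*} (α φ : ℝ) (x : Plane) (X : ℕ → Ω → Plane) (h : ℕ → Ω → ℝ)
    (ω : Ω) : Measure ℝ :=
  Measure.sum fun i => (visible φ x).indicator (fun _ => (1 : ℝ≥0∞)) (X i ω, h i ω) •
    Measure.dirac (invPower α x X h i ω)

lemma lintegral_invPowerMeasure {Ω : Type*} (α φ : ℝ) (x : Plane) (X : ℕ → Ω → Plane) (h : ℕ → Ω → ℝ)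
    (ω : Ω) {w : ℝ → ℝ≥0∞} (hw : Measurable w) :
    ∫⁻ z, w z ∂(invPowerMeasure α φ x X h ω) =
      ∑' i, (visible φ x).indicator (fun p => w (markInvPower α x p)) (X i ω, h i ω) := by
  rw [invPowerMeasure, lintegral_sum_measure]
  refine tsum_congr fun i => ?_
  rw [lintegral_smul_measure, lintegral_dirac' _ hw]
  by_cases hi : (X i ω, h i ω) ∈ visible φ x
  · simp [hi, invPower, markInvPower]
  · simp [hi]

lemma invPowerMeasure_apply {Ω : Type*} (α φ : ℝ) (x : Plane) (X : ℕ → Ω → Plane) (h : ℕ → Ω → ℝ)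
    (ω : Ω) {B : Set ℝ} (hB : MeasurableSet B) :
    invPowerMeasure α φ x X h ω B =
      ({i : ℕ | polarAngle (X i ω - x) ≤ φ ∧ invPower α x X h i ω ∈ B}.encard : ℝ≥0∞) := by
  rw [← lintegral_indicator_one hB, lintegral_invPowerMeasure _ _ _ _ _ _
    (measurable_one.indicator hB), ← ENNReal.tsum_set_one, tsum_subtype _ (fun _ => (1 : ℝ≥0∞))]
  refine tsum_congr fun i => ?_
  by_cases h1 : polarAngle (X i ω - x) ≤ φ <;> by_cases h2 : ‖X i ω - x‖ ^ α / h i ω ∈ B <;>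
    simp [indicator, visible, markInvPower, invPower, h1, h2]

/-- The inverse received powers of the visible nodes form a Poisson process. -/
theorem IsPoissonNetwork.isPoissonRandomMeasure {Ω : Type*} [MeasurableSpace Ω] {P : Measure Ω} [IsProbabilityMeasure P]
    {lam : ℝ} {ν : Measure ℝ} {X : ℕ → Ω → Plane} {h : ℕ → Ω → ℝ}
    (hnet : IsPoissonNetwork P lam ν X h) (α φ : ℝ) (x : Plane) :
    IsPoissonRandomMeasure P (invPowerMeasure α φ x X h)
      (((((ENNReal.ofReal lam • (volume : Measure Plane)).prod ν).restrict (visible φ x))).map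
        (markInvPower α x)) := by
  have hν : IsProbabilityMeasure ν := (hnet.gain_law 0).isProbabilityMeasure_iff.1 inferInstance
  have hσ : SigmaFinite (ENNReal.ofReal lam • (volume : Measure Plane)) :=
    inferInstanceAs (SigmaFinite (Real.toNNReal lam • (volume : Measure Plane)))
  have hY := measurable_markInvPower α x
  have hS := measurableSet_visible φ x
  refine ⟨?_, fun ω => by unfold invPowerMeasure; infer_instance, ?_, ?_⟩
  · refine Measure.measurable_of_measurable_coe _ fun B hB => ?_
    simp_rw [← lintegral_indicator_one hB, lintegral_invPowerMeasure _ _ _ _ _ _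
      (measurable_one.indicator hB)]
    exact Measurable.tsum fun i => ((((measurable_one.indicator hB).comp hY)).indicator hS).comp
      ((hnet.nodes.measurable i).prodMk (hnet.gain_measurable i))
  · intro ω B hB
    exact ⟨_, invPowerMeasure_apply _ _ _ _ _ _ hB⟩
  · intro w hw
    simp_rw [lintegral_invPowerMeasure _ _ _ _ _ _ hw]
    -- Extending the test function by 0 discards the invisible nodes, since 1 - e^{-0} = 0.
    have hv : Measurable ((visible φ x).indicator fun p => w (markInvPower α x p)) :=
      (hw.comp hY).indicator hS
    rw [hnet.nodes.laplace_marked hnet.gain_measurable hnet.gain_law hnet.gain_indep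
      hnet.gains_indep_nodes hv,
      lintegral_map (f := fun z => 1 - expNeg (w z)) (measurable_const.sub (measurable_expNeg.comp hw)) hY,
      ← lintegral_indicator hS]
    congr 1
    refine lintegral_congr fun p => ?_
    by_cases hp : p ∈ visible φ x <;> simp [hp, expNeg_zero]

end InversePower

/-! ### From the Laplace functional to independent Poisson counts. -/

section PoissonCounts

/-- Let x decrease to 0; the terms are dominated by |d k|. -/
lemma coeff_zero_eq_zero_of_tsum_eq_zero {d : ℕ → ℝ} (hd : Summable d)
    (H : ∀ x ∈ Ioo (0 : ℝ) 1, ∑' k, d k * x ^ k = 0) : d 0 = 0 := by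
  have h1 : Filter.Tendsto (fun x : ℝ => ∑' k, d k * x ^ k) (nhdsWithin 0 (Ioi 0))
      (nhds (∑' k, d k * (0 : ℝ) ^ k)) := by
    refine tendsto_tsum_of_dominated_convergence (bound := fun k => |d k|) hd.abs (fun k => ?_) ?_
    · have hc : Continuous fun x : ℝ => d k * x ^ k := by fun_prop
      exact (hc.tendsto 0).mono_left nhdsWithin_le_nhds
    · filter_upwards [Ioo_mem_nhdsGT (zero_lt_one' ℝ)] with x hx k
      rw [norm_mul, Real.norm_eq_abs, norm_pow, Real.norm_of_nonneg hx.1.le]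
      exact mul_le_of_le_one_right (abs_nonneg _) (pow_le_one₀ hx.1.le hx.2.le)
  have h2 : ∑' k, d k * (0 : ℝ) ^ k = d 0 := by
    rw [tsum_eq_single 0 fun k hk => by simp [hk]]; simp
  have h3 : Filter.Tendsto (fun x : ℝ => ∑' k, d k * x ^ k) (nhdsWithin 0 (Ioi 0)) (nhds 0) := by
    refine tendsto_const_nhds.congr' ?_
    filter_upwards [Ioo_mem_nhdsGT (zero_lt_one' ℝ)] with x hx using (H x hx).symm
  rw [← h2]
  exact tendsto_nhds_unique h1 h3

/-- Once the constant coefficient vanishes, the series can be divided by x, which shifts the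
coefficients by one. -/
lemma coeff_eq_zero_of_tsum_eq_zero (n : ℕ) {d : ℕ → ℝ} (hd : Summable d)
    (H : ∀ x ∈ Ioo (0 : ℝ) 1, ∑' k, d k * x ^ k = 0) : d n = 0 := by
  induction n generalizing d with
  | zero => exact coeff_zero_eq_zero_of_tsum_eq_zero hd H
  | succ n ih =>
    refine ih (d := fun k => d (k + 1)) ((summable_nat_add_iff 1).2 hd) fun x hx => ?_
    have hs : Summable fun k => d k * x ^ k := by
      refine Summable.of_norm_bounded hd.abs fun k => ?_
      rw [norm_mul, Real.norm_eq_abs, norm_pow, Real.norm_of_nonneg hx.1.le]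
      exact mul_le_of_le_one_right (abs_nonneg _) (pow_le_one₀ hx.1.le hx.2.le)
    have h1 := hs.tsum_eq_zero_add
    rw [H x hx, coeff_zero_eq_zero_of_tsum_eq_zero hd H, zero_mul, zero_add] at h1
    have h2 : ∑' k, d (k + 1) * x ^ (k + 1) = (∑' k, d (k + 1) * x ^ k) * x := by
      rw [← tsum_mul_right]
      exact tsum_congr fun k => by ring
    rw [h2] at h1
    exact (mul_eq_zero.1 h1.symm).resolve_right hx.1.ne'

lemma coeff_eq_of_tsum_eq {a b : ℕ → ℝ} (ha : Summable a) (hb : Summable b)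
    (H : ∀ x ∈ Ioo (0 : ℝ) 1, ∑' k, a k * x ^ k = ∑' k, b k * x ^ k) (n : ℕ) : a n = b n := by
  have key : ∀ {d : ℕ → ℝ}, Summable d → ∀ x ∈ Ioo (0 : ℝ) 1, Summable fun k => d k * x ^ k := by
    intro d hd x hx
    refine Summable.of_norm_bounded hd.abs fun k => ?_
    rw [norm_mul, Real.norm_eq_abs, norm_pow, Real.norm_of_nonneg hx.1.le]
    exact mul_le_of_le_one_right (abs_nonneg _) (pow_le_one₀ hx.1.le hx.2.le)
  refine sub_eq_zero.1 (coeff_eq_zero_of_tsum_eq_zero n (ha.sub hb) fun x hx => ?_)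
  simp_rw [sub_mul]
  rw [(key ha x hx).tsum_sub (key hb x hx), H x hx, sub_self]

/-- The probability that a Poisson variable of mean `m` equals `k`. -/
noncomputable def poissonWeight (m : ℝ) (k : ℕ) : ℝ := Real.exp (-m) * m ^ k / k.factorial

lemma poissonWeight_nonneg {m : ℝ} (hm : 0 ≤ m) (k : ℕ) : 0 ≤ poissonWeight m k := by
  unfold poissonWeight; positivity

lemma hasSum_poissonWeight_mul_pow (m x : ℝ) :
    HasSum (fun k => poissonWeight m k * x ^ k) (Real.exp (-(m * (1 - x)))) := by
  have h0 : HasSum (fun k : ℕ => (m * x) ^ k / k.factorial) (Real.exp (m * x)) := by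
    rw [Real.exp_eq_exp_ℝ]
    exact NormedSpace.expSeries_div_hasSum_exp (m * x)
  have h1 := h0.mul_left (Real.exp (-m))
  rw [← Real.exp_add] at h1
  convert! h1 using 1
  · funext k; rw [poissonWeight, mul_pow]; ring
  · congr 1; ring

lemma hasSum_poissonWeight (m : ℝ) : HasSum (poissonWeight m) 1 := by
  have := hasSum_poissonWeight_mul_pow m 1
  simpa using this

variable {Ω : Type*} [MeasurableSpace Ω] {P : Measure Ω}

/-- This is the generating function of N, weighted by V, at e^{-θ}. Since θ > 0, the event N = ∞
contributes nothing. -/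
lemma lintegral_expNeg_mul_eq_tsum {N V : Ω → ℝ≥0∞} (hN : Measurable N)
    (hint : ∀ ω, ∃ k : ℕ∞, N ω = k) (hV : Measurable V) {θ : ℝ} (hθ : 0 < θ) :
    ∫⁻ ω, expNeg (ENNReal.ofReal θ * N ω) * V ω ∂P =
      ∑' k : ℕ, (∫⁻ ω in {ω | N ω = k}, V ω ∂P) * ENNReal.ofReal (Real.exp (-θ) ^ k) := by
  have hms : ∀ k : ℕ, MeasurableSet {ω | N ω = k} := fun k => hN (measurableSet_singleton _)
  have h1 : ∀ ω, expNeg (ENNReal.ofReal θ * N ω) * V ω =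
      ∑' k : ℕ, {ω | N ω = k}.indicator V ω * ENNReal.ofReal (Real.exp (-θ) ^ k) := by
    intro ω
    obtain ⟨j, hj⟩ := hint ω
    induction j using ENat.recTopCoe with
    | top =>
      have hz : ∀ k : ℕ, {ω | N ω = k}.indicator V ω = 0 := fun k => by
        rw [indicator_of_notMem]
        simp [hj]
      simp_rw [hz]
      rw [hj, ENat.toENNReal_top, ENNReal.mul_top (by simpa using hθ), expNeg_top]
      simp
    | coe j =>
      rw [ENat.toENNReal_coe] at hj
      rw [tsum_eq_single j, indicator_of_mem (by simpa using hj), mul_comm, hj]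
      · congr 1
        rw [← ENNReal.ofReal_natCast j, ← ENNReal.ofReal_mul hθ.le, expNeg_ofReal (by positivity),
          ← Real.exp_nat_mul]
        congr 2; ring
      · intro k hk
        rw [indicator_of_notMem, zero_mul]
        simp only [mem_ofPred_eq, hj]
        exact fun h => hk (by exact_mod_cast h.symm)
  simp_rw [h1]
  rw [lintegral_tsum fun k => ((hV.indicator (hms k)).mul_const _).aemeasurable]
  refine tsum_congr fun k => ?_
  rw [lintegral_mul_const _ (hV.indicator (hms k)), lintegral_indicator (hms k)]

lemma tsum_setLIntegral_eq_le {N V : Ω → ℝ≥0∞} (hN : Measurable N) :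
    ∑' k : ℕ, ∫⁻ ω in {ω | N ω = k}, V ω ∂P ≤ ∫⁻ ω, V ω ∂P := by
  have hms : ∀ k : ℕ, MeasurableSet {ω | N ω = k} := fun k => hN (measurableSet_singleton _)
  rw [← lintegral_iUnion hms]
  · exact setLIntegral_le_lintegral _ _
  · intro k l hkl
    refine disjoint_left.2 fun ω (h1 : N ω = k) (h2 : N ω = l) => hkl ?_
    exact_mod_cast h1.symm.trans h2

/-- A generating function of Poisson type determines the partition of an integral according to the
value of an integer-valued variable. -/
lemma setLIntegral_eq_poissonWeight {N V : Ω → ℝ≥0∞} (hN : Measurable N)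
    (hint : ∀ ω, ∃ k : ℕ∞, N ω = k) (hV : Measurable V) (hVi : ∫⁻ ω, V ω ∂P ≠ ∞)
    {C : ℝ≥0∞} (hC : C ≠ ∞) {m : ℝ} (hm : 0 ≤ m)
    (H : ∀ θ : ℝ, 0 < θ → ∫⁻ ω, expNeg (ENNReal.ofReal θ * N ω) * V ω ∂P =
      C * expNeg (ENNReal.ofReal m * (1 - expNeg (ENNReal.ofReal θ)))) (k : ℕ) :
    ∫⁻ ω in {ω | N ω = k}, V ω ∂P = C * ENNReal.ofReal (poissonWeight m k) := by
  set A : ℕ → ℝ≥0∞ := fun k => ∫⁻ ω in {ω | N ω = k}, V ω ∂P with hA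
  have hsum : ∑' k, A k ≠ ∞ := ((tsum_setLIntegral_eq_le hN).trans_lt hVi.lt_top).ne
  have hAf : ∀ k, A k ≠ ∞ := ENNReal.ne_top_of_tsum_ne_top hsum
  have key := coeff_eq_of_tsum_eq (a := fun k => (A k).toReal)
    (b := fun k => C.toReal * poissonWeight m k) (ENNReal.summable_toReal hsum)
    ((hasSum_poissonWeight m).summable.mul_left _) (fun x hx => ?_) k
  · have := congrArg ENNReal.ofReal key
    rwa [ENNReal.ofReal_toReal (hAf k), ENNReal.ofReal_mul ENNReal.toReal_nonneg,
      ENNReal.ofReal_toReal hC] at this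
  -- Every x in (0, 1) is e^{-θ} with θ = -log x > 0, so the hypothesis identifies two power series
  -- on all of (0, 1).
  · have hθ : 0 < -Real.log x := by
      rw [neg_pos]; exact Real.log_neg hx.1 hx.2
    have h1 := H _ hθ
    rw [lintegral_expNeg_mul_eq_tsum hN hint hV hθ, expNeg_mul_one_sub hm hθ.le, neg_neg,
      Real.exp_log hx.1] at h1
    have h2 := congrArg ENNReal.toReal h1
    rw [ENNReal.tsum_toReal_eq (fun k => ENNReal.mul_ne_top (hAf k) ENNReal.ofReal_ne_top)] at h2
    simp only [ENNReal.toReal_mul] at h2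
    simp_rw [ENNReal.toReal_ofReal (pow_nonneg hx.1.le _)] at h2
    rw [ENNReal.toReal_ofReal (Real.exp_pos _).le] at h2
    rw [h2, ← (hasSum_poissonWeight_mul_pow m x).tsum_eq, ← tsum_mul_left]
    exact tsum_congr fun k => by ring

variable {η : Ω → Measure ℝ} {μ : Measure ℝ}

/-- Apply the Laplace functional to a·1_A + b·1_B + w. The three supports are disjoint, so 1 -
e^{-(·)} is additive over them and the exponential factorizes. -/
lemma IsPoissonRandomMeasure.joint_laplace (H : IsPoissonRandomMeasure P η μ) {A B : Set ℝ}
    (hA : MeasurableSet A) (hB : MeasurableSet B) (hAB : Disjoint A B) {w : ℝ → ℝ≥0∞}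
    (hw : Measurable w) (hwA : ∀ z ∈ A, w z = 0) (hwB : ∀ z ∈ B, w z = 0) (a b : ℝ≥0∞) :
    ∫⁻ ω, expNeg (a * η ω A) * (expNeg (b * η ω B) * expNeg (∫⁻ z, w z ∂(η ω))) ∂P =
      expNeg (μ A * (1 - expNeg a)) * (expNeg (μ B * (1 - expNeg b)) *
        expNeg (∫⁻ z, (1 - expNeg (w z)) ∂μ)) := by
  have hmA : Measurable (A.indicator fun _ => a) := measurable_const.indicator hA
  have hmB : Measurable (B.indicator fun _ => b) := measurable_const.indicator hB
  have h1 := H.laplace (fun z => A.indicator (fun _ => a) z + (B.indicator (fun _ => b) z + w z))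
    (hmA.add (hmB.add hw))
  have h2 : ∀ z, 1 - expNeg (A.indicator (fun _ => a) z + (B.indicator (fun _ => b) z + w z)) =
      A.indicator (fun _ => 1 - expNeg a) z + (B.indicator (fun _ => 1 - expNeg b) z +
        (1 - expNeg (w z))) := by
    intro z
    by_cases hz : z ∈ A
    · have hz' : z ∉ B := disjoint_left.1 hAB hz
      simp [hz, hz', hwA z hz, expNeg_zero]
    · by_cases hz' : z ∈ B
      · simp [hz, hz', hwB z hz', expNeg_zero]
      · simp [hz, hz']
  simp_rw [h2] at h1
  rw [lintegral_add_left (measurable_const.indicator hA),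
    lintegral_add_left (measurable_const.indicator hB), expNeg_add, expNeg_add,
    lintegral_indicator_const hA, lintegral_indicator_const hB, mul_comm _ (μ A),
    mul_comm _ (μ B)] at h1
  rw [← h1]
  refine lintegral_congr fun ω => ?_
  rw [lintegral_add_left hmA, lintegral_add_left hmB, lintegral_indicator_const hA,
    lintegral_indicator_const hB, expNeg_add, expNeg_add]

lemma IsPoissonRandomMeasure.measurable_apply (H : IsPoissonRandomMeasure P η μ) {A : Set ℝ}
    (hA : MeasurableSet A) : Measurable fun ω => η ω A :=
  (Measure.measurable_coe hA).comp H.measurable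

lemma IsPoissonRandomMeasure.measurable_lintegral (H : IsPoissonRandomMeasure P η μ)
    {w : ℝ → ℝ≥0∞} (hw : Measurable w) : Measurable fun ω => ∫⁻ z, w z ∂(η ω) :=
  (Measure.measurable_lintegral hw).comp H.measurable

/-- The numbers of points in disjoint sets `A` and `B` are independent Poisson variables,
independent of the points outside `A ∪ B`. -/
theorem IsPoissonRandomMeasure.setLIntegral_counts [IsProbabilityMeasure P]
    (H : IsPoissonRandomMeasure P η μ) {A B : Set ℝ}
    (hA : MeasurableSet A) (hB : MeasurableSet B) (hAB : Disjoint A B) (hμA : μ A ≠ ∞)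
    (hμB : μ B ≠ ∞) {w : ℝ → ℝ≥0∞}
    (hw : Measurable w) (hwA : ∀ z ∈ A, w z = 0) (hwB : ∀ z ∈ B, w z = 0) (k l : ℕ) :
    ∫⁻ ω in {ω | η ω A = k} ∩ {ω | η ω B = l}, expNeg (∫⁻ z, w z ∂(η ω)) ∂P =
      ENNReal.ofReal (poissonWeight (μ A).toReal k) *
        (ENNReal.ofReal (poissonWeight (μ B).toReal l) *
          expNeg (∫⁻ z, (1 - expNeg (w z)) ∂μ)) := by
  have hNA := H.measurable_apply hA
  have hNB := H.measurable_apply hB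
  have hE : Measurable fun ω => expNeg (∫⁻ z, w z ∂(η ω)) :=
    measurable_expNeg.comp (H.measurable_lintegral hw)
  have hSB : ∀ l : ℕ, MeasurableSet {ω | η ω B = l} := fun l => hNB (measurableSet_singleton _)
  have hSA : ∀ l : ℕ, MeasurableSet {ω | η ω A = l} := fun l => hNA (measurableSet_singleton _)
  have hle : ∀ f : Ω → ℝ≥0∞, (∀ ω, f ω ≤ 1) → ∫⁻ ω, f ω ∂P ≠ ∞ := fun f hf =>
    ((lintegral_mono hf).trans_lt (by simp)).ne
  -- The generating function is inverted one variable at a time: first the count of B with θ fixed,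
  -- then the count of A.
  have step1 : ∀ θ : ℝ, 0 < θ →
      ∫⁻ ω, expNeg (ENNReal.ofReal θ * η ω A) *
        {ω | η ω B = l}.indicator (fun ω => expNeg (∫⁻ z, w z ∂(η ω))) ω ∂P =
      (ENNReal.ofReal (poissonWeight (μ B).toReal l) *
        expNeg (∫⁻ z, (1 - expNeg (w z)) ∂μ)) *
        expNeg (ENNReal.ofReal (μ A).toReal * (1 - expNeg (ENNReal.ofReal θ))) := by
    intro θ hθ
    have h1 := setLIntegral_eq_poissonWeight (P := P) (N := fun ω => η ω B)
      (V := fun ω => expNeg (ENNReal.ofReal θ * η ω A) * expNeg (∫⁻ z, w z ∂(η ω)))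
      hNB (fun ω => H.integer ω B hB) ((measurable_expNeg.comp (hNA.const_mul _)).mul hE)
      (hle _ fun ω => mul_le_one' (expNeg_le_one _) (expNeg_le_one _))
      (C := expNeg (μ A * (1 - expNeg (ENNReal.ofReal θ))) *
        expNeg (∫⁻ z, (1 - expNeg (w z)) ∂μ))
      (ENNReal.mul_ne_top (expNeg_ne_top _) (expNeg_ne_top _)) (m := (μ B).toReal)
      ENNReal.toReal_nonneg (fun θ' _ => ?_) l
    · rw [ENNReal.ofReal_toReal hμA]
      rw [← lintegral_indicator (hSB l)] at h1
      calc _ = ∫⁻ ω, {ω | η ω B = l}.indicator (fun ω =>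
            expNeg (ENNReal.ofReal θ * η ω A) * expNeg (∫⁻ z, w z ∂(η ω))) ω ∂P := by
            refine lintegral_congr fun ω => ?_
            by_cases hω : ω ∈ {ω | η ω B = l}
            · simp only [indicator_of_mem hω]
            · simp only [indicator_of_notMem hω, mul_zero]
        _ = _ := h1
        _ = _ := by ring
    · have h2 := H.joint_laplace hA hB hAB hw hwA hwB (ENNReal.ofReal θ) (ENNReal.ofReal θ')
      rw [ENNReal.ofReal_toReal hμB]
      calc _ = _ := lintegral_congr fun ω => by ring
        _ = _ := h2
        _ = _ := by ring
  have hEB : ∀ ω, {ω | η ω B = l}.indicator (fun ω => expNeg (∫⁻ z, w z ∂(η ω))) ω ≤ 1 := by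
    classical
    intro ω
    rw [indicator_apply]
    split_ifs
    exacts [expNeg_le_one _, zero_le_one]
  have h3 := setLIntegral_eq_poissonWeight (P := P) (N := fun ω => η ω A) hNA
    (fun ω => H.integer ω A hA) (hE.indicator (hSB l))
    (hle _ hEB)
    (ENNReal.mul_ne_top ENNReal.ofReal_ne_top (expNeg_ne_top _)) ENNReal.toReal_nonneg step1 k
  rw [setLIntegral_indicator (hSB l)] at h3
  rw [inter_comm, h3, mul_comm]

theorem IsPoissonRandomMeasure.measure_count_eq [IsProbabilityMeasure P]
    (H : IsPoissonRandomMeasure P η μ) {A : Set ℝ} (hA : MeasurableSet A) (hμA : μ A ≠ ∞) (k : ℕ) :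
    P {ω | η ω A = k} = ENNReal.ofReal (poissonWeight (μ A).toReal k) := by
  have := H.setLIntegral_counts hA MeasurableSet.empty (disjoint_empty A) hμA (by simp)
    (w := fun _ => 0) measurable_const (by simp) (by simp) k 0
  simpa [expNeg_zero, poissonWeight] using this

end PoissonCounts

/-! ### Sector areas and the intensity c·z^δ. -/

section Intensity

/-- The measure on `(0, ∞)` that gives mass `c * z ^ δ` to `(0, z]`. -/
noncomputable def powerMeasure (c δ : ℝ) : Measure ℝ :=
  (volume.restrict (Ioi (0 : ℝ))).withDensity fun z => ENNReal.ofReal (c * δ * z ^ (δ - 1))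

lemma measurable_powerDensity (c δ : ℝ) :
    Measurable fun z : ℝ => ENNReal.ofReal (c * δ * z ^ (δ - 1)) := by fun_prop

lemma powerMeasure_Iic_of_nonpos (c δ : ℝ) {z : ℝ} (hz : z ≤ 0) :
    powerMeasure c δ (Iic z) = 0 := by
  rw [powerMeasure, withDensity_apply _ measurableSet_Iic, Measure.restrict_restrict
    measurableSet_Iic, Iic_inter_Ioi, Ioc_eq_empty (not_lt.2 hz)]
  simp

lemma ae_pos_powerMeasure (c δ : ℝ) : ∀ᵐ z ∂(powerMeasure c δ), 0 < z := by
  rw [ae_iff]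
  convert! powerMeasure_Iic_of_nonpos c δ le_rfl using 2
  ext z; simp

lemma powerMeasure_Ioc {c δ : ℝ} (hc : 0 ≤ c) (hδ : 0 < δ) {a b : ℝ} (ha : 0 ≤ a) (hab : a ≤ b) :
    powerMeasure c δ (Ioc a b) = ENNReal.ofReal (c * b ^ δ - c * a ^ δ) := by
  have hi : IntervalIntegrable (fun z : ℝ => c * δ * z ^ (δ - 1)) volume a b :=
    (intervalIntegral.intervalIntegrable_rpow' (by linarith)).const_mul _
  rw [powerMeasure, withDensity_apply _ measurableSet_Ioc, Measure.restrict_restrict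
    measurableSet_Ioc, inter_eq_left.2 (show Ioc a b ⊆ Ioi 0 from fun z hz => ha.trans_lt hz.1),
    ← ofReal_integral_eq_lintegral_ofReal, ← intervalIntegral.integral_of_le hab]
  · congr 1
    rw [intervalIntegral.integral_const_mul, integral_rpow (Or.inl (by linarith)), sub_add_cancel]
    field_simp
  · exact (intervalIntegrable_iff_integrableOn_Ioc_of_le hab).1 hi
  · refine (ae_restrict_iff' measurableSet_Ioc).2 (Filter.Eventually.of_forall fun z hz => ?_)
    have : 0 ≤ z := ha.trans hz.1.le
    simp only [Pi.zero_apply]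
    positivity

lemma powerMeasure_Iic {c δ : ℝ} (hc : 0 ≤ c) (hδ : 0 < δ) {z : ℝ} (hz : 0 ≤ z) :
    powerMeasure c δ (Iic z) = ENNReal.ofReal (c * z ^ δ) := by
  rw [← Iic_union_Ioc_eq_Iic hz, measure_union _ measurableSet_Ioc,
    powerMeasure_Iic_of_nonpos c δ le_rfl, powerMeasure_Ioc hc hδ le_rfl hz,
    Real.zero_rpow hδ.ne', mul_zero, sub_zero, zero_add]
  exact disjoint_left.2 fun z h1 h2 => not_lt.2 h1 h2.1

lemma eq_of_Iic_eq {μ ν : Measure ℝ} (hμ : ∀ z, μ (Iic z) ≠ ∞) (h : ∀ z, μ (Iic z) = ν (Iic z)) :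
    μ = ν := by
  refine Measure.ext_of_Ioc' μ ν (fun a b _ => ?_) fun a b hab => ?_
  · exact ((measure_mono Ioc_subset_Iic_self).trans_lt (hμ b).lt_top).ne
  · rw [← Iic_sdiff_Iic, measure_sdiff (Iic_subset_Iic.2 hab.le)
      measurableSet_Iic.nullMeasurableSet (hμ a), measure_sdiff (Iic_subset_Iic.2 hab.le)
      measurableSet_Iic.nullMeasurableSet (h a ▸ hμ a), h, h]

/-- The angle in `[0, 2π)` corresponding to an angle in `(-π, π]`. -/
noncomputable def liftAngle (θ : ℝ) : ℝ := if 0 ≤ θ then θ else θ + 2 * Real.pi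

lemma measurable_liftAngle : Measurable liftAngle :=
  Measurable.ite (measurableSet_le measurable_const measurable_id) measurable_id
    (measurable_id.add_const _)

/-- For φ > π the admissible principal arguments form two intervals, [0, π) and (-π, φ - 2π]; for φ
≤ π only [0, φ] remains. End points do not affect the length. -/
lemma volume_liftAngle_le {φ : ℝ} (hφ : φ ≤ 2 * Real.pi) :
    volume ({θ | liftAngle θ ≤ φ} ∩ Ioo (-Real.pi) Real.pi) = ENNReal.ofReal φ := by
  have hπ := Real.pi_pos
  rcases le_or_gt φ Real.pi with h | h
  · apply le_antisymm
    · refine (measure_mono (t := Icc 0 φ) ?_).trans (by rw [Real.volume_Icc, sub_zero])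
      rintro θ ⟨h1, h2⟩
      simp only [mem_ofPred_eq, liftAngle] at h1
      split_ifs at h1 with h0
      · exact ⟨h0, h1⟩
      · linarith [h2.1]
    · refine le_trans (by rw [Real.volume_Ico, sub_zero]) (measure_mono (s := Ico 0 φ) ?_)
      rintro θ ⟨h1, h2⟩
      refine ⟨?_, by linarith, by linarith⟩
      simp only [mem_ofPred_eq, liftAngle, if_pos h1]
      exact h2.le
  · have hsplit : ENNReal.ofReal φ =
        ENNReal.ofReal (φ - 2 * Real.pi - -Real.pi) + ENNReal.ofReal (Real.pi - 0) := by
      rw [← ENNReal.ofReal_add (by linarith) (by linarith)]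
      congr 1; ring
    apply le_antisymm
    · refine (measure_mono (t := Icc (-Real.pi) (φ - 2 * Real.pi) ∪ Icc 0 Real.pi) ?_).trans
        ((measure_union_le _ _).trans (by rw [Real.volume_Icc, Real.volume_Icc, hsplit]))
      rintro θ ⟨h1, h2⟩
      simp only [mem_ofPred_eq, liftAngle] at h1
      split_ifs at h1 with h0
      · exact Or.inr ⟨h0, h2.2.le⟩
      · exact Or.inl ⟨h2.1.le, by linarith⟩
    · have hd : Disjoint (Ioo (-Real.pi) (φ - 2 * Real.pi)) (Ico 0 Real.pi) :=
        disjoint_left.2 fun θ h1 h2 => by linarith [h1.2, h2.1]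
      rw [hsplit, ← Real.volume_Ico (a := 0), ← Real.volume_Ioo (a := -Real.pi), ← measure_union hd measurableSet_Ico]
      refine measure_mono ?_
      rintro θ (⟨h1, h2⟩ | ⟨h1, h2⟩)
      · refine ⟨?_, by linarith, by linarith⟩
        simp only [mem_ofPred_eq, liftAngle, if_neg (show ¬ 0 ≤ θ by linarith)]
        linarith
      · refine ⟨?_, by linarith, by linarith⟩
        simp only [mem_ofPred_eq, liftAngle, if_pos h1]
        linarith

/-- Area of a sector of the complex plane. -/
lemma volume_complex_sector {φ r : ℝ} (hφ : φ ≤ 2 * Real.pi) (hr : 0 ≤ r) :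
    volume {w : ℂ | liftAngle (Complex.arg w) ≤ φ ∧ ‖w‖ ≤ r} =
      ENNReal.ofReal (φ / 2 * r ^ 2) := by
  have hS : MeasurableSet {w : ℂ | liftAngle (Complex.arg w) ≤ φ ∧ ‖w‖ ≤ r} :=
    (measurableSet_le (measurable_liftAngle.comp Complex.measurable_arg) measurable_const).inter
      (measurableSet_le measurable_norm measurable_const)
  have hL : MeasurableSet {θ | liftAngle θ ≤ φ} :=
    measurableSet_le measurable_liftAngle measurable_const
  have hρ : Measurable fun ρ : ℝ => (Iic r).indicator ENNReal.ofReal ρ :=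
    ENNReal.measurable_ofReal.indicator measurableSet_Iic
  have hθ : Measurable fun θ : ℝ => {θ | liftAngle θ ≤ φ}.indicator (1 : ℝ → ℝ≥0∞) θ :=
    measurable_one.indicator hL
  rw [← lintegral_indicator_one hS, ← Complex.lintegral_comp_polarCoord_symm]
  have ht : polarCoord.target = Ioi (0 : ℝ) ×ˢ Ioo (-Real.pi) Real.pi := rfl
  have h1 : ∫⁻ p in polarCoord.target, ENNReal.ofReal p.1 •
      {w : ℂ | liftAngle (Complex.arg w) ≤ φ ∧ ‖w‖ ≤ r}.indicator (1 : ℂ → ℝ≥0∞)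
        (Complex.polarCoord.symm p) =
      ∫⁻ p in polarCoord.target, (Iic r).indicator ENNReal.ofReal p.1 *
        {θ | liftAngle θ ≤ φ}.indicator (1 : ℝ → ℝ≥0∞) p.2 := by
    -- In polar coordinates the indicator of the sector is a product of a radial and an angular
    -- indicator, so the integral factorizes.
    refine setLIntegral_congr_fun (ht ▸ measurableSet_Ioi.prod measurableSet_Ioo) ?_
    rintro ⟨ρ, θ⟩ ⟨h0, h2⟩
    have h0' : 0 < ρ := h0
    have harg : Complex.arg (Complex.polarCoord.symm (ρ, θ)) = θ := by
      rw [Complex.polarCoord_symm_apply, Complex.ofReal_cos, Complex.ofReal_sin]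
      exact Complex.arg_mul_cos_add_sin_mul_I h0' ⟨h2.1, h2.2.le⟩
    have hnorm : ‖Complex.polarCoord.symm (ρ, θ)‖ = ρ := by
      rw [Complex.norm_polarCoord_symm, abs_of_pos h0']
    by_cases ha : liftAngle θ ≤ φ <;> by_cases hb : ρ ≤ r <;>
      simp only [indicator, mem_ofPred_eq, harg, hnorm, ha, hb, mem_Iic, and_true, and_false,
        if_true, if_false, smul_eq_mul, mul_zero, zero_mul, Pi.one_apply]
  rw [h1, ht, Measure.volume_eq_prod, ← Measure.prod_restrict,
    lintegral_prod_mul hρ.aemeasurable hθ.aemeasurable, lintegral_indicator_one hL,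
    Measure.restrict_apply hL, volume_liftAngle_le hφ, lintegral_indicator measurableSet_Iic,
    Measure.restrict_restrict measurableSet_Iic, Iic_inter_Ioi,
    ← ofReal_integral_eq_lintegral_ofReal, ← intervalIntegral.integral_of_le hr, integral_id,
    ← ENNReal.ofReal_mul (by simpa using by positivity)]
  · congr 1; ring
  · exact (continuous_id.integrableOn_Icc).mono_set Ioc_subset_Icc_self
  · exact (ae_restrict_iff' measurableSet_Ioc).2 (Filter.Eventually.of_forall fun z hz => hz.1.le)

lemma volume_plane_sector {φ r : ℝ} (hφ : φ ≤ 2 * Real.pi) (hr : 0 ≤ r) (x : Plane) :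
    volume {y : Plane | polarAngle (y - x) ≤ φ ∧ ‖y - x‖ ≤ r} =
      ENNReal.ofReal (φ / 2 * r ^ 2) := by
  have hS : MeasurableSet {w : ℂ | liftAngle (Complex.arg w) ≤ φ ∧ ‖w‖ ≤ r} :=
    (measurableSet_le (measurable_liftAngle.comp Complex.measurable_arg) measurable_const).inter
      (measurableSet_le measurable_norm measurable_const)
  have hmp : MeasurePreserving (fun y : Plane => Complex.measurableEquivPi.symm (WithLp.ofLp (y - x)))
      volume volume :=
    (Complex.volume_preserving_equiv_pi.symm.comp (PiLp.volume_preserving_ofLp (Fin 2))).comp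
      (measurePreserving_sub_right volume x)
  rw [← volume_complex_sector hφ hr, ← hmp.measure_preimage hS.nullMeasurableSet]
  congr 1
  ext y
  have h1 : Complex.measurableEquivPi.symm (WithLp.ofLp (y - x)) = ⟨(y - x) 0, (y - x) 1⟩ := by
    rw [Complex.measurableEquivPi_symm_apply]
    apply Complex.ext <;> simp
  have h2 : ‖(⟨(y - x) 0, (y - x) 1⟩ : ℂ)‖ = ‖y - x‖ := by
    rw [EuclideanSpace.norm_eq, Complex.norm_def, Complex.normSq_mk]
    simp [Fin.sum_univ_two, sq]
  rw [mem_preimage, h1, mem_ofPred_eq, mem_ofPred_eq, h2]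
  rfl

lemma rpow_div_le_iff {α t z d : ℝ} (hα : 0 < α) (ht : 0 < t) (hz : 0 ≤ z) (hd : 0 ≤ d) :
    d ^ α / t ≤ z ↔ d ≤ (z * t) ^ (1 / α) := by
  have hzt : 0 ≤ z * t := mul_nonneg hz ht.le
  rw [div_le_iff₀ ht]
  conv_lhs => rw [← Real.rpow_inv_rpow hzt hα.ne', ← one_div]
  exact Real.rpow_le_rpow_iff hd (Real.rpow_nonneg hzt _) hα

/-- The intensity measure of the inverse received powers of the visible nodes. -/
theorem map_markInvPower_eq {lam α φ : ℝ} (hlam : 0 < lam) (hα : 2 < α) (hφ0 : 0 < φ)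
    (hφ : φ ≤ 2 * Real.pi) {ν : Measure ℝ} [SFinite ν] (hν_pos : ∀ᵐ t ∂ν, 0 < t)
    (hν_int : Integrable (fun t : ℝ => t ^ (2 / α)) ν) (x : Plane) :
    (((ENNReal.ofReal lam • (volume : Measure Plane)).prod ν).restrict (visible φ x)).map
        (markInvPower α x) = powerMeasure (1 / 2 * gainMoment α ν * φ * lam) (2 / α) := by
  have hα0 : 0 < α := by linarith
  have hδ : 0 < 2 / α := by positivity
  have hmom : 0 ≤ gainMoment α ν := integral_nonneg_of_ae
    (hν_pos.mono fun t ht => Real.rpow_nonneg ht.le _)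
  have hY := measurable_markInvPower α x
  have key : ∀ z, ((((ENNReal.ofReal lam • (volume : Measure Plane)).prod ν).restrict
      (visible φ x)).map (markInvPower α x)) (Iic z) =
      powerMeasure (1 / 2 * gainMoment α ν * φ * lam) (2 / α) (Iic z) := by
    intro z
    have hms : MeasurableSet (markInvPower α x ⁻¹' Iic z ∩ visible φ x) :=
      (hY measurableSet_Iic).inter (measurableSet_visible φ x)
    rw [Measure.map_apply hY measurableSet_Iic, Measure.restrict_apply (hY measurableSet_Iic),
      Measure.prod_apply_symm hms]
    rcases lt_or_ge z 0 with hz | hz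
    · rw [powerMeasure_Iic_of_nonpos _ _ hz.le, lintegral_eq_zero_iff' (by
        exact (measurable_measure_prodMk_right hms).aemeasurable)]
      filter_upwards [hν_pos] with t ht
      have : (fun y => (y, t)) ⁻¹' (markInvPower α x ⁻¹' Iic z ∩ visible φ x) = ∅ := by
        ext y
        simp only [mem_preimage, mem_inter_iff, mem_Iic, mem_empty_iff_false, iff_false, not_and]
        intro h1
        have : 0 ≤ markInvPower α x (y, t) := div_nonneg (by positivity) ht.le
        linarith
      rw [this]; simp
    · have h1 : ∀ᵐ t ∂ν, (ENNReal.ofReal lam • (volume : Measure Plane))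
          ((fun y => (y, t)) ⁻¹' (markInvPower α x ⁻¹' Iic z ∩ visible φ x)) =
          ENNReal.ofReal (lam * (φ / 2 * z ^ (2 / α)) * t ^ (2 / α)) := by
        filter_upwards [hν_pos] with t ht
        -- For a fixed gain t the slice is a sector of radius (z·t)^{1/α}, of area
        -- (φ/2)·(z·t)^{2/α}; integrating in t produces the gain moment.
        have hset : (fun y => (y, t)) ⁻¹' (markInvPower α x ⁻¹' Iic z ∩ visible φ x) =
            {y : Plane | polarAngle (y - x) ≤ φ ∧ ‖y - x‖ ≤ (z * t) ^ (1 / α)} := by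
          ext y
          simp only [mem_preimage, mem_inter_iff, mem_Iic, visible, markInvPower, mem_ofPred_eq]
          rw [rpow_div_le_iff hα0 ht hz (norm_nonneg _), and_comm]
        rw [hset, Measure.smul_apply, volume_plane_sector hφ (by positivity), smul_eq_mul,
          ← ENNReal.ofReal_mul hlam.le]
        congr 1
        rw [← Real.rpow_natCast, ← Real.rpow_mul (by positivity), Real.mul_rpow hz ht.le]
        have : 1 / α * ((2 : ℕ) : ℝ) = 2 / α := by push_cast; ring
        rw [this]; ring
      rw [lintegral_congr_ae h1, ← ofReal_integral_eq_lintegral_ofReal (hν_int.const_mul _),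
        integral_const_mul, powerMeasure_Iic (by positivity) hδ hz]
      · congr 1
        rw [gainMoment]; ring
      · filter_upwards [hν_pos] with t ht
        simp only [Pi.zero_apply]
        positivity
  refine eq_of_Iic_eq (fun z => ?_) key
  rw [key]
  rcases le_total z 0 with hz | hz
  · rw [powerMeasure_Iic_of_nonpos _ _ hz]; simp
  · rw [powerMeasure_Iic (by positivity) hδ hz]; simp

end Intensity

/-! ### The continued incomplete gamma function and the conditional exponent. -/

section IncompleteGamma

lemma integrableOn_rpow_mul_exp_neg {a b : ℝ} (ha : a ≤ 1) (hb : 0 < b) :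
    IntegrableOn (fun t : ℝ => t ^ (a - 1) * Real.exp (-t)) (Ioi b) := by
  have hc : ContinuousOn (fun t : ℝ => t ^ (a - 1) * Real.exp (-t)) (Ioi b) := by
    refine ContinuousOn.mul (fun t ht => ?_) (by fun_prop)
    exact (Real.continuousAt_rpow_const t _ (Or.inl (hb.trans ht).ne')).continuousWithinAt
  refine Integrable.mono' ((integrableOn_exp_neg_Ioi b).const_mul (b ^ (a - 1)))
    (hc.aestronglyMeasurable measurableSet_Ioi) ?_
  refine (ae_restrict_iff' measurableSet_Ioi).2 (Filter.Eventually.of_forall fun t ht => ?_)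
  have ht0 : 0 < t := hb.trans ht
  rw [Real.norm_of_nonneg (by positivity)]
  exact mul_le_mul_of_nonneg_right
    (Real.rpow_le_rpow_of_nonpos hb (le_of_lt ht) (by linarith)) (Real.exp_pos _).le

/-- Near b the function is a constant plus an integral from the fixed end b/2, so the fundamental
theorem applies although the integral from 0 may diverge. -/
lemma hasDerivAt_lowerGamma {a b : ℝ} (ha : a ≤ 1) (hb : 0 < b) :
    HasDerivAt (lowerGamma a) (b ^ (a - 1) * Real.exp (-b)) b := by
  have hb2 : 0 < b / 2 := by positivity
  have hcont : ∀ t : ℝ, 0 < t → ContinuousAt (fun t : ℝ => t ^ (a - 1) * Real.exp (-t)) t :=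
    fun t ht => (Real.continuousAt_rpow_const t _ (Or.inl ht.ne')).mul (by fun_prop)
  have hint := integrableOn_rpow_mul_exp_neg ha hb2
  have hii : ∀ y, b / 2 ≤ y → IntervalIntegrable (fun t : ℝ => t ^ (a - 1) * Real.exp (-t))
      volume (b / 2) y := fun y hy =>
    (intervalIntegrable_iff_integrableOn_Ioc_of_le hy).2 (hint.mono_set Ioc_subset_Ioi_self)
  have h1 : HasDerivAt (fun y => ∫ t in (b / 2)..y, t ^ (a - 1) * Real.exp (-t))
      (b ^ (a - 1) * Real.exp (-b)) b := by
    refine intervalIntegral.integral_hasDerivAt_right (hii b (by linarith)) ?_ (hcont b hb)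
    exact ⟨Ioi (b / 2), Ioi_mem_nhds (by linarith), hint.aestronglyMeasurable⟩
  have h2 : lowerGamma a =ᶠ[nhds b] fun y => (∫ t in (b / 2)..y, t ^ (a - 1) * Real.exp (-t)) +
      (Real.Gamma a - ∫ t in Ioi (b / 2), t ^ (a - 1) * Real.exp (-t)) := by
    filter_upwards [Ioi_mem_nhds (show b / 2 < b by linarith)] with y hy
    have hy' : b / 2 ≤ y := le_of_lt hy
    have h3 := setIntegral_union (μ := volume) (f := fun t : ℝ => t ^ (a - 1) * Real.exp (-t))
      (disjoint_left.2 fun t (h1 : t ∈ Ioc (b / 2) y) (h2 : t ∈ Ioi y) => not_lt.2 h1.2 h2)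
      measurableSet_Ioi (hint.mono_set Ioc_subset_Ioi_self)
      (hint.mono_set (Ioi_subset_Ioi hy'))
    rw [Ioc_union_Ioi_eq_Ioi hy'] at h3
    rw [lowerGamma, intervalIntegral.integral_of_le hy', h3]
    ring
  exact (h1.add_const _).congr_of_eventuallyEq h2

/-- Integration by parts: the integrand on the left is the derivative of -t^{-δ} e^{-t}. -/
lemma upperGamma_recurrence {δ b : ℝ} (hδ : 0 < δ) (hb : 0 < b) :
    δ * (∫ t in Ioi b, t ^ (-δ - 1) * Real.exp (-t)) + (∫ t in Ioi b, t ^ (1 - δ - 1) * Real.exp (-t)) =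
      b ^ (-δ) * Real.exp (-b) := by
  have i1 := (integrableOn_rpow_mul_exp_neg (a := -δ) (by linarith) hb).const_mul δ
  have i2 := integrableOn_rpow_mul_exp_neg (a := 1 - δ) (by linarith) hb
  have hd : ∀ t : ℝ, 0 < t → HasDerivAt (fun t : ℝ => -(t ^ (-δ) * Real.exp (-t)))
      (δ * (t ^ (-δ - 1) * Real.exp (-t)) + t ^ (1 - δ - 1) * Real.exp (-t)) t := by
    intro t ht
    have e1 := Real.hasDerivAt_rpow_const (p := -δ) (Or.inl ht.ne')
    have e2 : HasDerivAt (fun t : ℝ => Real.exp (-t)) (Real.exp (-t) * -1) t :=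
      (hasDerivAt_neg t).exp
    refine (e1.mul e2).neg.congr_deriv ?_
    rw [show 1 - δ - 1 = -δ by ring]; ring
  have hlim : Filter.Tendsto (fun t : ℝ => -(t ^ (-δ) * Real.exp (-t))) Filter.atTop (nhds 0) := by
    have := (tendsto_rpow_neg_atTop hδ).mul Real.tendsto_exp_neg_atTop_nhds_zero
    simpa using this.neg
  have h := integral_Ioi_of_hasDerivAt_of_tendsto (a := b)
    (hd b hb).continuousAt.continuousWithinAt (fun t ht => hd t (hb.trans ht)) (i1.add i2) hlim
  rw [integral_add i1 i2, integral_const_mul] at h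
  rw [h]; ring

/-- The recurrence raises the parameter from -δ to 1 - δ > 0 and isolates the singular term
-b^{-δ}/δ. What is left is [b^{-δ}(1 - e^{-b}) - γ(1-δ, b)]/δ, and both terms are O(b^{1-δ}). The
bound gives both the decay of the exponent as z → ∞ and its linear control as s → 0. -/
lemma abs_lowerGamma_add_le {δ b : ℝ} (hδ : 0 < δ) (hδ1 : δ < 1) (hb : 0 < b) :
    |lowerGamma (-δ) b + b ^ (-δ) / δ| ≤ (1 / δ + 1 / (δ * (1 - δ))) * b ^ (1 - δ) := by
  have h1δ : 0 < 1 - δ := by linarith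
  have hG : Real.Gamma (1 - δ) = -δ * Real.Gamma (-δ) := by
    rw [← Real.Gamma_add_one (by linarith)]; congr 1; ring
  have hrec := upperGamma_recurrence hδ hb
  have heq : lowerGamma (-δ) b + b ^ (-δ) / δ =
      b ^ (-δ) * (1 - Real.exp (-b)) / δ - lowerGamma (1 - δ) b / δ := by
    rw [lowerGamma, lowerGamma, hG]
    field_simp
    linear_combination (-1 : ℝ) * hrec
  have hγ0 : 0 ≤ lowerGamma (1 - δ) b := by
    rw [lowerGamma_of_pos h1δ hb.le]
    exact setIntegral_nonneg measurableSet_Ioc fun t ht =>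
      mul_nonneg (Real.rpow_nonneg ht.1.le _) (Real.exp_pos _).le
  have hγ1 : lowerGamma (1 - δ) b ≤ b ^ (1 - δ) / (1 - δ) := by
    have hi : IntervalIntegrable (fun t : ℝ => t ^ (1 - δ - 1)) volume 0 b :=
      intervalIntegral.intervalIntegrable_rpow' (by linarith)
    rw [lowerGamma_of_pos h1δ hb.le]
    calc ∫ t in Ioc 0 b, t ^ (1 - δ - 1) * Real.exp (-t)
        ≤ ∫ t in Ioc 0 b, t ^ (1 - δ - 1) := by
          refine setIntegral_mono_on ?_ ?_ measurableSet_Ioc fun t ht => ?_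
          · have : IntegrableOn (fun t : ℝ => t ^ (1 - δ - 1) * Real.exp (-t)) (Ioi 0) := by
              simpa only [mul_comm] using Real.GammaIntegral_convergent h1δ
            exact this.mono_set Ioc_subset_Ioi_self
          · exact (intervalIntegrable_iff_integrableOn_Ioc_of_le hb.le).1 hi
          · exact mul_le_of_le_one_right (Real.rpow_nonneg ht.1.le _)
              (Real.exp_le_one_iff.2 (by linarith [ht.1]))
      _ = b ^ (1 - δ) / (1 - δ) := by
          rw [← intervalIntegral.integral_of_le hb.le, integral_rpow (Or.inl (by linarith)),
            sub_add_cancel, Real.zero_rpow h1δ.ne', sub_zero]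
  have he0 : 0 ≤ 1 - Real.exp (-b) := sub_nonneg.2 (Real.exp_le_one_iff.2 (by linarith))
  have he1 : b ^ (-δ) * (1 - Real.exp (-b)) ≤ b ^ (1 - δ) := by
    rw [show 1 - δ = -δ + 1 by ring, Real.rpow_add_one hb.ne']
    refine mul_le_mul_of_nonneg_left ?_ (Real.rpow_nonneg hb.le _)
    linarith [Real.add_one_le_exp (-b)]
  rw [heq]
  refine (abs_sub _ _).trans ?_
  rw [abs_of_nonneg (by positivity), abs_of_nonneg (by positivity), add_mul]
  refine add_le_add ?_ ?_
  · rw [div_eq_inv_mul, ← one_div]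
    exact mul_le_mul_of_nonneg_left he1 (by positivity)
  · calc lowerGamma (1 - δ) b / δ ≤ (b ^ (1 - δ) / (1 - δ)) / δ := by gcongr
      _ = 1 / (δ * (1 - δ)) * b ^ (1 - δ) := by field_simp

/-- Logarithm of the conditional Laplace transform, given that the `n`-th inverse power is `z`. -/
noncomputable def logLaplace (c δ s z : ℝ) : ℝ :=
  c * z ^ δ + c * δ * s ^ δ * lowerGamma (-δ) (s / z)

variable {c δ s : ℝ}

/-- The term c·z^δ is exactly what cancels the singularity of γ(-δ, b) at b = s/z → 0. -/
lemma logLaplace_eq (hδ : 0 < δ) (hs : 0 < s) {z : ℝ} (hz : 0 < z) :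
    logLaplace c δ s z = c * δ * s ^ δ * (lowerGamma (-δ) (s / z) + (s / z) ^ (-δ) / δ) := by
  rw [logLaplace, Real.div_rpow hs.le hz.le, Real.rpow_neg hs.le, Real.rpow_neg hz.le]
  have h1 : s ^ δ ≠ 0 := (Real.rpow_pos_of_pos hs _).ne'
  have h2 : z ^ δ ≠ 0 := (Real.rpow_pos_of_pos hz _).ne'
  field_simp
  ring

lemma tendsto_logLaplace (hc : 0 ≤ c) (hδ : 0 < δ) (hδ1 : δ < 1) (hs : 0 < s) :
    Filter.Tendsto (logLaplace c δ s) Filter.atTop (nhds 0) := by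
  have h1 : Filter.Tendsto (fun z : ℝ => c * δ * s ^ δ *
      ((1 / δ + 1 / (δ * (1 - δ))) * (s / z) ^ (1 - δ))) Filter.atTop (nhds 0) := by
    have h2 : Filter.Tendsto (fun z : ℝ => s / z) Filter.atTop (nhds 0) :=
      Filter.Tendsto.const_div_atTop Filter.tendsto_id s
    have h3 := h2.rpow_const (p := 1 - δ) (Or.inr (by linarith))
    rw [Real.zero_rpow (by linarith)] at h3
    simpa using (h3.const_mul (1 / δ + 1 / (δ * (1 - δ)))).const_mul (c * δ * s ^ δ)
  refine squeeze_zero_norm' ?_ h1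
  filter_upwards [Filter.eventually_gt_atTop 0] with z hz
  rw [logLaplace_eq hδ hs hz, norm_mul, Real.norm_of_nonneg (by positivity)]
  exact mul_le_mul_of_nonneg_left (abs_lowerGamma_add_le hδ hδ1 (by positivity)) (by positivity)

/-- The derivative is the intensity density times 1 - e^{-s/z}. Together with the limit 0 at
infinity, this identifies the closed form with minus the tail integral. -/
lemma hasDerivAt_logLaplace (hδ : 0 < δ) (hs : 0 < s) {z : ℝ} (hz : 0 < z) :
    HasDerivAt (logLaplace c δ s) (c * δ * z ^ (δ - 1) * (1 - Real.exp (-(s / z)))) z := by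
  have h1 := (Real.hasDerivAt_rpow_const (p := δ) (Or.inl hz.ne')).const_mul c
  have h2 : HasDerivAt (fun z : ℝ => s / z) (-s / z ^ 2) z := by
    refine ((hasDerivAt_const z s).fun_div (hasDerivAt_id' z) hz.ne').congr_deriv ?_
    simp
  have h3 := (hasDerivAt_lowerGamma (a := -δ) (by linarith) (div_pos hs hz)).comp z h2
  refine (h1.add (h3.const_mul (c * δ * s ^ δ))).congr_deriv ?_
  rw [Real.div_rpow hs.le hz.le, Real.rpow_sub_one hs.ne', Real.rpow_sub_one hz.ne',
    Real.rpow_sub_one hz.ne', Real.rpow_neg hs.le, Real.rpow_neg hz.le]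
  have h1 : s ^ δ ≠ 0 := (Real.rpow_pos_of_pos hs _).ne'
  have h2 : z ^ δ ≠ 0 := (Real.rpow_pos_of_pos hz _).ne'
  field_simp
  ring

lemma one_sub_exp_neg_div_nonneg (hs : 0 < s) {z : ℝ} (hz : 0 < z) :
    0 ≤ 1 - Real.exp (-(s / z)) :=
  sub_nonneg.2 (Real.exp_le_one_iff.2 (by have := div_pos hs hz; linarith))

lemma setLIntegral_powerMeasure_Ioi {z : ℝ} (hz : 0 ≤ z) (w : ℝ → ℝ≥0∞)
    (hw : Measurable w) :
    ∫⁻ y in Ioi z, w y ∂(powerMeasure c δ) =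
      ∫⁻ y in Ioi z, ENNReal.ofReal (c * δ * y ^ (δ - 1)) * w y := by
  rw [powerMeasure, restrict_withDensity measurableSet_Ioi,
    lintegral_withDensity_eq_lintegral_mul _ (measurable_powerDensity c δ) hw,
    Measure.restrict_restrict measurableSet_Ioi,
    inter_eq_left.2 (show Ioi z ⊆ Ioi 0 from Ioi_subset_Ioi hz)]
  rfl

/-- The exponent of the Laplace functional of the interference beyond `z`. -/
lemma setLIntegral_one_sub_expNeg (hc : 0 ≤ c) (hδ : 0 < δ) (hδ1 : δ < 1) (hs : 0 < s) {z : ℝ}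
    (hz : 0 < z) :
    ∫⁻ y in Ioi z, (1 - expNeg (ENNReal.ofReal (s / y))) ∂(powerMeasure c δ) =
      ENNReal.ofReal (-logLaplace c δ s z) ∧ logLaplace c δ s z ≤ 0 := by
  have hnn : ∀ y ∈ Ioi z, 0 ≤ c * δ * y ^ (δ - 1) * (1 - Real.exp (-(s / y))) := fun y hy => by
    have hy0 : 0 < y := hz.trans hy
    have := one_sub_exp_neg_div_nonneg hs hy0
    positivity
  have h1 := integral_Ioi_of_hasDerivAt_of_nonneg' (a := z)
    (fun y hy => hasDerivAt_logLaplace (c := c) hδ hs (hz.trans_le hy)) hnn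
    (tendsto_logLaplace hc hδ hδ1 hs)
  have h2 := integrableOn_Ioi_deriv_of_nonneg' (a := z)
    (fun y hy => hasDerivAt_logLaplace (c := c) hδ hs (hz.trans_le hy)) hnn
    (tendsto_logLaplace hc hδ hδ1 hs)
  rw [zero_sub] at h1
  refine ⟨?_, ?_⟩
  · have hw : Measurable fun y : ℝ => 1 - expNeg (ENNReal.ofReal (s / y)) :=
      measurable_const.sub (measurable_expNeg.comp (by fun_prop))
    rw [setLIntegral_powerMeasure_Ioi hz.le _ hw, ← h1, ofReal_integral_eq_lintegral_ofReal h2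
      ((ae_restrict_iff' measurableSet_Ioi).2 (Filter.Eventually.of_forall hnn))]
    refine setLIntegral_congr_fun measurableSet_Ioi fun y hy => ?_
    have hy0 : 0 < y := hz.trans hy
    rw [expNeg_ofReal (by positivity), ← ENNReal.ofReal_one,
      ← ENNReal.ofReal_sub _ (Real.exp_pos _).le, ← ENNReal.ofReal_mul (by positivity)]
  · have := setIntegral_nonneg (μ := volume) measurableSet_Ioi hnn
    linarith

/-- Provides an integrable majorant under the law of z_n. For z ≤ 1 the upper incomplete gamma
integral from s/z is at most the one from s; for z ≥ 1 the tail integral is at most its value at 1.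
-/
lemma abs_logLaplace_sub_le (hc : 0 ≤ c) (hδ : 0 < δ) (hδ1 : δ < 1) (hs : 0 < s) :
    ∃ M, ∀ z, 0 < z → |logLaplace c δ s z| ≤ M + c * z ^ δ := by
  have hU : ∀ b, 0 < b → 0 ≤ ∫ t in Ioi b, t ^ (-δ - 1) * Real.exp (-t) := fun b hb =>
    setIntegral_nonneg measurableSet_Ioi fun t ht =>
      mul_nonneg (Real.rpow_nonneg (hb.trans ht).le _) (Real.exp_pos _).le
  refine ⟨|logLaplace c δ s 1| + c * δ * s ^ δ *
    (|Real.Gamma (-δ)| + ∫ t in Ioi s, t ^ (-δ - 1) * Real.exp (-t)), fun z hz => ?_⟩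
  have hz0 : 0 ≤ c * z ^ δ := by positivity
  have hM : 0 ≤ c * δ * s ^ δ *
      (|Real.Gamma (-δ)| + ∫ t in Ioi s, t ^ (-δ - 1) * Real.exp (-t)) := by
    have := hU s hs
    positivity
  rcases le_total z 1 with h | h
  · have hsz : s ≤ s / z := by rw [le_div_iff₀ hz]; nlinarith
    have h1 : ∫ t in Ioi (s / z), t ^ (-δ - 1) * Real.exp (-t) ≤
        ∫ t in Ioi s, t ^ (-δ - 1) * Real.exp (-t) := by
      refine setIntegral_mono_set (integrableOn_rpow_mul_exp_neg (by linarith) hs)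
        ((ae_restrict_iff' measurableSet_Ioi).2 (Filter.Eventually.of_forall fun t ht => ?_))
        (Filter.Eventually.of_forall (Ioi_subset_Ioi hsz))
      exact mul_nonneg (Real.rpow_nonneg (hs.trans ht).le _) (Real.exp_pos _).le
    have h2 : |lowerGamma (-δ) (s / z)| ≤
        |Real.Gamma (-δ)| + ∫ t in Ioi s, t ^ (-δ - 1) * Real.exp (-t) := by
      rw [lowerGamma]
      refine (abs_sub _ _).trans (add_le_add le_rfl ?_)
      rw [abs_of_nonneg (hU _ (by positivity))]
      exact h1
    calc |logLaplace c δ s z| ≤ c * z ^ δ + c * δ * s ^ δ * |lowerGamma (-δ) (s / z)| := by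
          rw [logLaplace]
          refine (abs_add_le _ _).trans ?_
          rw [abs_of_nonneg hz0, abs_mul, abs_of_nonneg (show 0 ≤ c * δ * s ^ δ by positivity)]
      _ ≤ c * z ^ δ + c * δ * s ^ δ *
          (|Real.Gamma (-δ)| + ∫ t in Ioi s, t ^ (-δ - 1) * Real.exp (-t)) := by gcongr
      _ ≤ _ := by linarith [abs_nonneg (logLaplace c δ s 1)]
  · have h1 := setLIntegral_one_sub_expNeg hc hδ hδ1 hs hz
    have h2 := setLIntegral_one_sub_expNeg hc hδ hδ1 hs one_pos
    have h3 : ENNReal.ofReal (-logLaplace c δ s z) ≤ ENNReal.ofReal (-logLaplace c δ s 1) := by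
      rw [← h1.1, ← h2.1]
      exact lintegral_mono_set (Ioi_subset_Ioi h)
    rw [ENNReal.ofReal_le_ofReal_iff (by linarith [h2.2])] at h3
    rw [abs_of_nonpos h1.2, abs_of_nonpos h2.2]
    linarith

end IncompleteGamma

/-! ### Deterministic facts on locally finite configurations. -/

section PointConfigurations

/-- The `n`-th smallest point of a point configuration on the line. -/
noncomputable def nthPoint (η : Measure ℝ) (n : ℕ) : ℝ := sInf {t : ℝ | (n : ℝ≥0∞) ≤ η (Iic t)}

/-- Configurations of infinitely many points in `(0, ∞)`, finitely many of them in bounded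
intervals. -/
structure IsPointConfiguration (η : Measure ℝ) : Prop where
  finite : ∀ a, η (Iic a) ≠ ∞
  pos : η (Iic 0) = 0
  infinite : η univ = ∞
  integer : ∀ B, MeasurableSet B → ∃ k : ℕ∞, η B = k
  sFinite : SFinite η

variable {η : Measure ℝ}

lemma IsPointConfiguration.exists_le (H : IsPointConfiguration η) (n : ℕ) :
    ∃ t : ℝ, (n : ℝ≥0∞) ≤ η (Iic t) := by
  have h1 : Filter.Tendsto (fun k : ℕ => η (Iic (k : ℝ))) Filter.atTop (nhds (η univ)) := by
    have hu : (⋃ k : ℕ, Iic (k : ℝ)) = univ :=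
      iUnion_Iic_of_not_bddAbove_range (by
        rintro ⟨B, hB⟩
        obtain ⟨k, hk⟩ := exists_nat_gt B
        exact not_lt.2 (hB ⟨k, rfl⟩) hk)
    rw [← hu]
    exact tendsto_measure_iUnion_atTop fun k l hkl => Iic_subset_Iic.2 (by exact_mod_cast hkl)
  rw [H.infinite] at h1
  obtain ⟨k, hk⟩ := (h1.eventually (lt_mem_nhds (ENNReal.natCast_lt_top n))).exists
  exact ⟨k, hk.le⟩

lemma IsPointConfiguration.bddBelow (H : IsPointConfiguration η) {n : ℕ} (hn : 1 ≤ n) :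
    BddBelow {t : ℝ | (n : ℝ≥0∞) ≤ η (Iic t)} := by
  refine ⟨0, fun t ht => ?_⟩
  by_contra hlt
  have h1 : η (Iic t) = 0 :=
    le_antisymm ((measure_mono (Iic_subset_Iic.2 (not_le.1 hlt).le)).trans H.pos.le) zero_le
  have h2 : (n : ℝ≥0∞) ≤ η (Iic t) := ht
  rw [h1] at h2
  have : n = 0 := by simpa using h2
  omega

/-- The infimum is attained: the masses of half lines are finite, so t ↦ η(-∞, t] is
right-continuous. -/
lemma IsPointConfiguration.nthPoint_le_iff (H : IsPointConfiguration η) {n : ℕ} (hn : 1 ≤ n)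
    (t : ℝ) : nthPoint η n ≤ t ↔ (n : ℝ≥0∞) ≤ η (Iic t) := by
  refine ⟨fun h => ?_, fun h => csInf_le (H.bddBelow hn) h⟩
  have h1 : ∀ y > t, (n : ℝ≥0∞) ≤ η (Iic y) := fun y hy => by
    obtain ⟨u, hu, huy⟩ := exists_lt_of_csInf_lt (H.exists_le n) (h.trans_lt hy)
    exact le_trans hu (measure_mono (Iic_subset_Iic.2 huy.le))
  obtain ⟨u, hu1, hu2, hu3⟩ := exists_seq_strictAnti_tendsto t
  have h2 : Filter.Tendsto (fun k => η (Iic (u k))) Filter.atTop (nhds (η (⋂ k, Iic (u k)))) :=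
    tendsto_measure_iInter_atTop (fun k => measurableSet_Iic.nullMeasurableSet)
      (fun k l hkl => Iic_subset_Iic.2 (hu1.antitone hkl)) ⟨0, H.finite _⟩
  have h3 : (⋂ k, Iic (u k)) = Iic t := by
    ext y
    simp only [mem_iInter, mem_Iic]
    exact ⟨fun hy => ge_of_tendsto' hu3 hy, fun hy k => hy.trans (hu2 k).le⟩
  rw [h3] at h2
  exact ge_of_tendsto' h2 fun k => h1 _ (hu2 k)

lemma IsPointConfiguration.nthPoint_pos (H : IsPointConfiguration η) {n : ℕ} (hn : 1 ≤ n) :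
    0 < nthPoint η n := by
  by_contra h
  rw [not_lt, H.nthPoint_le_iff hn, H.pos] at h
  have : n = 0 := by simpa using h
  omega

/-- Layer-cake form of 1/z, which turns sums of inverses of ordered points into integrals of
counting functions. -/
lemma lintegral_Ici_inv_sq {z : ℝ} (hz : 0 < z) :
    ∫⁻ y in Ici z, ENNReal.ofReal (1 / y ^ 2) = ENNReal.ofReal (1 / z) := by
  have hd : ∀ y ∈ Ici z, HasDerivAt (fun y : ℝ => -(1 / y)) (1 / y ^ 2) y := fun y hy => by
    have hy0 : y ≠ 0 := (hz.trans_le hy).ne'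
    have := (hasDerivAt_inv hy0).neg
    simpa [Pi.neg_def] using this
  have hl : Filter.Tendsto (fun y : ℝ => -(1 / y)) Filter.atTop (nhds 0) := by
    simpa using (tendsto_inv_atTop_zero (𝕜 := ℝ)).neg
  have hp : ∀ y ∈ Ioi z, (0 : ℝ) ≤ 1 / y ^ 2 := fun y _ => by positivity
  have h1 := integral_Ioi_of_hasDerivAt_of_nonneg' hd hp hl
  have h2 := integrableOn_Ioi_deriv_of_nonneg' hd hp hl
  rw [setLIntegral_congr Ioi_ae_eq_Ici.symm, ← ofReal_integral_eq_lintegral_ofReal h2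
    ((ae_restrict_iff' measurableSet_Ioi).2 (Filter.Eventually.of_forall hp)), h1]
  congr 1; ring

lemma tsum_if_add_le (n : ℕ) (m : ℕ∞) :
    ∑' k : ℕ, (if ((n + 1 + k : ℕ) : ℝ≥0∞) ≤ (m : ℝ≥0∞) then (1 : ℝ≥0∞) else 0) =
      (m : ℝ≥0∞) - n := by
  induction m using ENat.recTopCoe with
  | top => simp
  | coe m =>
    rw [ENat.toENNReal_coe, tsum_eq_sum (s := Finset.range (m - n)), Finset.sum_congr rfl
      (g := fun _ => (1 : ℝ≥0∞))]
    · rw [Finset.sum_const, Finset.card_range, nsmul_one, ENNReal.natCast_sub]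
    · intro k hk
      rw [if_pos]
      have := Finset.mem_range.1 hk
      exact_mod_cast (show n + 1 + k ≤ m by omega)
    · intro k hk
      rw [if_neg]
      have : ¬ k < m - n := fun h => hk (Finset.mem_range.2 h)
      exact_mod_cast (show ¬ n + 1 + k ≤ m by omega)

/-- The sum of the inverses of the points after the `n`-th one, if exactly `n` points are at most
`b`. -/
lemma IsPointConfiguration.tsum_inv_nthPoint (H : IsPointConfiguration η) {n : ℕ} {b : ℝ}
    (hb0 : 0 ≤ b) (hb : η (Iic b) = n) :
    ∑' k : ℕ, ENNReal.ofReal (nthPoint η (n + 1 + k))⁻¹ =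
      ∫⁻ z in Ioi b, ENNReal.ofReal (1 / z) ∂η := by
  have := H.sFinite
  have hφm : Measurable fun y : ℝ => ENNReal.ofReal (1 / y ^ 2) := by fun_prop
  -- The k-th ordered point is at most y iff k ≤ η(-∞, y], so no enumeration of the atoms is needed.
  have hL : ∀ k : ℕ, ENNReal.ofReal (nthPoint η (n + 1 + k))⁻¹ =
      ∫⁻ y in Ioi 0, ENNReal.ofReal (1 / y ^ 2) *
        (if ((n + 1 + k : ℕ) : ℝ≥0∞) ≤ η (Iic y) then (1 : ℝ≥0∞) else 0) := by
    intro k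
    have hz := H.nthPoint_pos (show 1 ≤ n + 1 + k by omega)
    rw [← one_div, ← lintegral_Ici_inv_sq hz, ← inter_eq_left.2 (show
      Ici (nthPoint η (n + 1 + k)) ⊆ Ioi 0 from fun y hy => hz.trans_le hy),
      ← setLIntegral_indicator measurableSet_Ici]
    refine lintegral_congr fun y => ?_
    by_cases hy : y ∈ Ici (nthPoint η (n + 1 + k))
    · rw [indicator_of_mem hy, if_pos ((H.nthPoint_le_iff (by omega) y).1 hy), mul_one]
    · rw [indicator_of_notMem hy, if_neg (fun h => hy ((H.nthPoint_le_iff (by omega) y).2 h)),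
        mul_zero]
  have hmono : Monotone fun y => η (Iic y) := fun y y' h => measure_mono (Iic_subset_Iic.2 h)
  simp_rw [hL]
  have hms : ∀ k : ℕ, Measurable fun y => ENNReal.ofReal (1 / y ^ 2) *
      (if ((n + 1 + k : ℕ) : ℝ≥0∞) ≤ η (Iic y) then (1 : ℝ≥0∞) else 0) := fun k =>
    hφm.mul (Measurable.ite (measurableSet_le measurable_const hmono.measurable)
      measurable_const measurable_const)
  rw [← lintegral_tsum fun k => (hms k).aemeasurable]
  -- The number of k > n with k ≤ η(-∞, y] is the truncated difference η(-∞, y] - n, which is η(b,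
  -- y] since η(-∞, b] = n.
  have hLs : ∀ y, ∑' k : ℕ, ENNReal.ofReal (1 / y ^ 2) *
      (if ((n + 1 + k : ℕ) : ℝ≥0∞) ≤ η (Iic y) then (1 : ℝ≥0∞) else 0) =
      ENNReal.ofReal (1 / y ^ 2) * η (Ioc b y) := by
    intro y
    obtain ⟨m, hm⟩ := H.integer (Iic y) measurableSet_Iic
    rw [ENNReal.tsum_mul_left, hm, tsum_if_add_le, ← hm, ← hb]
    congr 1
    rcases le_total b y with h | h
    · rw [← Iic_sdiff_Iic, measure_sdiff (Iic_subset_Iic.2 h) measurableSet_Iic.nullMeasurableSet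
        (H.finite b)]
    · rw [Ioc_eq_empty (not_lt.2 h), measure_empty]
      exact tsub_eq_zero_of_le (hmono h)
  simp_rw [hLs]
  -- The same layer-cake formula for the integral over η; Tonelli then brings it to the form already
  -- found.
  have hR : ∫⁻ z in Ioi b, ENNReal.ofReal (1 / z) ∂η =
      ∫⁻ z in Ioi b, ∫⁻ y in Ioi 0, (Ici z).indicator (fun y => ENNReal.ofReal (1 / y ^ 2)) y
        ∂volume ∂η := by
    refine setLIntegral_congr_fun measurableSet_Ioi fun z hz => ?_
    have hz0 : 0 < z := hb0.trans_lt hz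
    rw [setLIntegral_indicator (measurableSet_Ici (a := z)), inter_eq_left.2 (show
      Ici z ⊆ Ioi 0 from fun y hy => hz0.trans_le hy), lintegral_Ici_inv_sq hz0]
  rw [hR, lintegral_lintegral_swap]
  · refine lintegral_congr fun y => ?_
    have : ∀ z, (Ici z).indicator (fun y => ENNReal.ofReal (1 / y ^ 2)) y =
        (Iic y).indicator (fun _ => ENNReal.ofReal (1 / y ^ 2)) z := fun z => by
      simp [indicator]
    simp_rw [this]
    rw [lintegral_indicator_const measurableSet_Iic, Measure.restrict_apply measurableSet_Iic,
      Iic_inter_Ioi]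
  · have hs : MeasurableSet {p : ℝ × ℝ | p.1 ≤ p.2} := measurableSet_le measurable_fst measurable_snd
    have : Measurable ({p : ℝ × ℝ | p.1 ≤ p.2}.indicator fun p => ENNReal.ofReal (1 / p.2 ^ 2)) :=
      (hφm.comp measurable_snd).indicator hs
    exact this.aemeasurable

end PointConfigurations

/-! ### The law of the (m+1)-st point and its moments. -/

section NthPointLaw

lemma hasDerivAt_poissonWeight_succ (u : ℝ) (m : ℕ) :
    HasDerivAt (fun u => poissonWeight u (m + 1)) (poissonWeight u m - poissonWeight u (m + 1)) u := by
  have h1 : HasDerivAt (fun u : ℝ => Real.exp (-u)) (Real.exp (-u) * -1) u := (hasDerivAt_neg u).exp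
  have h2 := (h1.mul (hasDerivAt_pow (m + 1) u)).div_const ((m + 1).factorial : ℝ)
  refine h2.congr_deriv ?_
  rw [poissonWeight, poissonWeight, Nat.factorial_succ]
  have : (m.factorial : ℝ) ≠ 0 := by positivity
  push_cast
  field_simp
  ring

/-- The derivatives of consecutive weights telescope. With u = c·z^δ, this differentiates the
probability of at most m points up to z. -/
lemma hasDerivAt_sum_poissonWeight (u : ℝ) (m : ℕ) :
    HasDerivAt (fun u => ∑ k ∈ Finset.range (m + 1), poissonWeight u k) (-poissonWeight u m) u := by
  induction m with
  | zero =>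
    have h1 : HasDerivAt (fun u : ℝ => Real.exp (-u)) (Real.exp (-u) * -1) u :=
      (hasDerivAt_neg u).exp
    simpa [poissonWeight] using h1
  | succ m ih =>
    simp_rw [Finset.sum_range_succ _ (m + 1)]
    exact (ih.add (hasDerivAt_poissonWeight_succ u m)).congr_deriv (by ring)

lemma continuous_poissonWeight (m : ℕ) : Continuous fun u => poissonWeight u m := by
  unfold poissonWeight; fun_prop

lemma tendsto_poissonWeight (m : ℕ) :
    Filter.Tendsto (fun u => poissonWeight u m) Filter.atTop (nhds 0) := by
  have := (Real.tendsto_pow_mul_exp_neg_atTop_nhds_zero m).div_const (m.factorial : ℝ)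
  rw [zero_div] at this
  refine this.congr fun u => ?_
  rw [poissonWeight, mul_comm]

lemma poissonWeight_mul_self (u : ℝ) (m : ℕ) :
    u * poissonWeight u m = (m + 1) * poissonWeight u (m + 1) := by
  rw [poissonWeight, poissonWeight, Nat.factorial_succ]
  push_cast
  field_simp
  ring

/-- The law of the `(m + 1)`-st point of a Poisson process with intensity `powerMeasure c δ`. -/
noncomputable def nthPointLaw (c δ : ℝ) (m : ℕ) : Measure ℝ :=
  (powerMeasure c δ).withDensity fun z => ENNReal.ofReal (poissonWeight (c * z ^ δ) m)

variable {c δ : ℝ}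

lemma measurable_poissonWeight_rpow (c δ : ℝ) (m : ℕ) :
    Measurable fun z : ℝ => ENNReal.ofReal (poissonWeight (c * z ^ δ) m) :=
  ENNReal.measurable_ofReal.comp ((continuous_poissonWeight m).measurable.comp (by fun_prop))

lemma nthPointLaw_Ioi (hc : 0 < c) (hδ : 0 < δ) (m : ℕ) {t : ℝ} (ht : 0 ≤ t) :
    nthPointLaw c δ m (Ioi t) =
      ENNReal.ofReal (∑ k ∈ Finset.range (m + 1), poissonWeight (c * t ^ δ) k) := by
  set g : ℝ → ℝ := fun z => -∑ k ∈ Finset.range (m + 1), poissonWeight (c * z ^ δ) k with hg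
  have hd : ∀ z ∈ Ioi t, HasDerivAt g (c * δ * z ^ (δ - 1) * poissonWeight (c * z ^ δ) m) z := by
    intro z hz
    have hz0 : 0 < z := ht.trans_lt hz
    have h1 := (Real.hasDerivAt_rpow_const (p := δ) (Or.inl hz0.ne')).const_mul c
    have h2 := ((hasDerivAt_sum_poissonWeight (c * z ^ δ) m).comp z h1).neg
    exact h2.congr_deriv (by ring)
  have hcont : Continuous g := by
    refine (continuous_finsetSum _ fun k _ => (continuous_poissonWeight k).comp ?_).neg
    exact continuous_const.mul (Real.continuous_rpow_const hδ.le)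
  have hp : ∀ z ∈ Ioi t, 0 ≤ c * δ * z ^ (δ - 1) * poissonWeight (c * z ^ δ) m := fun z hz => by
    have hz0 : 0 < z := ht.trans_lt hz
    have := poissonWeight_nonneg (show 0 ≤ c * z ^ δ by positivity) m
    positivity
  have hl : Filter.Tendsto g Filter.atTop (nhds 0) := by
    have hu : Filter.Tendsto (fun z : ℝ => c * z ^ δ) Filter.atTop Filter.atTop :=
      (tendsto_rpow_atTop hδ).const_mul_atTop hc
    have := (tendsto_finsetSum (Finset.range (m + 1)) fun k _ => (tendsto_poissonWeight k).comp hu).neg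
    simpa using this
  have h1 := integral_Ioi_of_hasDerivAt_of_nonneg hcont.continuousWithinAt hd hp hl
  have h2 := integrableOn_Ioi_deriv_of_nonneg hcont.continuousWithinAt hd hp hl
  rw [nthPointLaw, withDensity_apply _ measurableSet_Ioi,
    setLIntegral_powerMeasure_Ioi ht _ (measurable_poissonWeight_rpow c δ m)]
  have h3 : ∫⁻ y in Ioi t, ENNReal.ofReal (c * δ * y ^ (δ - 1)) *
      ENNReal.ofReal (poissonWeight (c * y ^ δ) m) =
      ∫⁻ y in Ioi t, ENNReal.ofReal (c * δ * y ^ (δ - 1) * poissonWeight (c * y ^ δ) m) := by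
    refine setLIntegral_congr_fun measurableSet_Ioi fun y hy => ?_
    have hy0 : 0 < y := ht.trans_lt hy
    exact (ENNReal.ofReal_mul (by positivity)).symm
  rw [h3, ← ofReal_integral_eq_lintegral_ofReal h2
    ((ae_restrict_iff' measurableSet_Ioi).2 (Filter.Eventually.of_forall hp)), h1, hg]
  congr 1; ring

lemma nthPointLaw_Iic_zero (c δ : ℝ) (m : ℕ) : nthPointLaw c δ m (Iic 0) = 0 :=
  withDensity_absolutelyContinuous _ _ (powerMeasure_Iic_of_nonpos c δ le_rfl)

lemma ae_pos_nthPointLaw (c δ : ℝ) (m : ℕ) : ∀ᵐ z ∂(nthPointLaw c δ m), 0 < z := by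
  rw [ae_iff]
  convert! nthPointLaw_Iic_zero c δ m using 2
  ext z; simp

lemma isProbabilityMeasure_nthPointLaw (hc : 0 < c) (hδ : 0 < δ) (m : ℕ) :
    IsProbabilityMeasure (nthPointLaw c δ m) := by
  constructor
  have hd : Disjoint (Iic (0 : ℝ)) (Ioi 0) := disjoint_left.2 fun z (h1 : z ≤ 0) (h2 : 0 < z) =>
    not_lt.2 h1 h2
  rw [← Iic_union_Ioi (a := (0 : ℝ)), measure_union hd measurableSet_Ioi, nthPointLaw_Iic_zero, zero_add, nthPointLaw_Ioi hc hδ m le_rfl,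
    Real.zero_rpow hδ.ne', mul_zero, Finset.sum_range_succ']
  simp [poissonWeight]

/-- Multiplying the Poisson weight m by its mean gives m + 1 times the weight m + 1, so the moment
is m + 1 times the total mass of the law of the next point. -/
lemma lintegral_mul_rpow_nthPointLaw (hc : 0 < c) (hδ : 0 < δ) (m : ℕ) :
    ∫⁻ z, ENNReal.ofReal (c * z ^ δ) ∂(nthPointLaw c δ m) = ENNReal.ofReal (m + 1) := by
  have := isProbabilityMeasure_nthPointLaw hc hδ (m + 1)
  have hm : Measurable fun z : ℝ => ENNReal.ofReal (c * z ^ δ) := by fun_prop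
  rw [nthPointLaw, lintegral_withDensity_eq_lintegral_mul _ (measurable_poissonWeight_rpow c δ m) hm]
  have h1 : ∫⁻ z, ENNReal.ofReal (m + 1) * ENNReal.ofReal (poissonWeight (c * z ^ δ) (m + 1))
      ∂(powerMeasure c δ) = ENNReal.ofReal (m + 1) := by
    rw [lintegral_const_mul _ (measurable_poissonWeight_rpow c δ (m + 1)),
      ← setLIntegral_univ, ← withDensity_apply _ MeasurableSet.univ]
    change _ * nthPointLaw c δ (m + 1) univ = _
    rw [measure_univ, mul_one]
  rw [← h1]
  refine lintegral_congr_ae ((ae_pos_powerMeasure c δ).mono fun z hz => ?_)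
  have h2 : 0 ≤ c * z ^ δ := by positivity
  simp only [Pi.mul_apply]
  rw [← ENNReal.ofReal_mul (poissonWeight_nonneg h2 m), ← ENNReal.ofReal_mul (by positivity),
    mul_comm, poissonWeight_mul_self]

lemma integral_mul_rpow_nthPointLaw (hc : 0 < c) (hδ : 0 < δ) (m : ℕ) :
    Integrable (fun z => c * z ^ δ) (nthPointLaw c δ m) ∧
      ∫ z, c * z ^ δ ∂(nthPointLaw c δ m) = m + 1 := by
  have h0 : 0 ≤ᵐ[nthPointLaw c δ m] fun z => c * z ^ δ := by
    filter_upwards [ae_pos_nthPointLaw c δ m] with z hz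
    simp only [Pi.zero_apply]
    positivity
  have hm : Measurable fun z : ℝ => c * z ^ δ := by fun_prop
  have h1 := lintegral_mul_rpow_nthPointLaw hc hδ m
  refine ⟨(lintegral_ofReal_ne_top_iff_integrable hm.aestronglyMeasurable h0).1 (by simp [h1]), ?_⟩
  rw [integral_eq_lintegral_of_nonneg_ae h0 hm.aestronglyMeasurable, h1,
    ENNReal.toReal_ofReal (by positivity)]

end NthPointLaw

/-! ### Almost sure properties of the Poisson points. -/

section PoissonPoints

variable {Ω : Type*} [MeasurableSpace Ω] {P : Measure Ω} [IsProbabilityMeasure P]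
  {η : Ω → Measure ℝ}

lemma IsPoissonRandomMeasure.ae_ne_top {μ : Measure ℝ} (H : IsPoissonRandomMeasure P η μ)
    {A : Set ℝ} (hA : MeasurableSet A) (hμA : μ A ≠ ∞) : ∀ᵐ ω ∂P, η ω A ≠ ∞ := by
  have hN := H.measurable_apply hA
  have hms : ∀ k : ℕ, MeasurableSet {ω | η ω A = k} := fun k => hN (measurableSet_singleton _)
  have h1 : P (⋃ k : ℕ, {ω | η ω A = k}) = 1 := by
    rw [measure_iUnion _ hms]
    · simp_rw [H.measure_count_eq hA hμA]
      rw [← ENNReal.ofReal_tsum_of_nonneg (fun k => poissonWeight_nonneg ENNReal.toReal_nonneg k)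
        (hasSum_poissonWeight _).summable, (hasSum_poissonWeight _).tsum_eq, ENNReal.ofReal_one]
    · intro k l hkl
      refine disjoint_left.2 fun ω (h1 : η ω A = k) (h2 : η ω A = l) => hkl ?_
      exact_mod_cast h1.symm.trans h2
  have h2 : ∀ᵐ ω ∂P, ω ∈ ⋃ k : ℕ, {ω | η ω A = k} :=
    (prob_compl_eq_zero_iff (MeasurableSet.iUnion hms)).2 h1
  filter_upwards [h2] with ω hω
  obtain ⟨k, hk⟩ := mem_iUnion.1 hω
  have hk' : η ω A = k := hk
  rw [hk']
  exact ENNReal.natCast_ne_top k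

variable {c δ : ℝ}

lemma powerMeasure_Iic_ne_top (hc : 0 ≤ c) (hδ : 0 < δ) (a : ℝ) :
    powerMeasure c δ (Iic a) ≠ ∞ := by
  rcases le_total a 0 with h | h
  · rw [powerMeasure_Iic_of_nonpos c δ h]; simp
  · rw [powerMeasure_Iic hc hδ h]; simp

lemma powerMeasure_univ (hc : 0 < c) (hδ : 0 < δ) : powerMeasure c δ univ = ∞ := by
  have hu : Filter.Tendsto (fun z : ℝ => ENNReal.ofReal (c * z ^ δ)) Filter.atTop (nhds ∞) :=
    ENNReal.tendsto_ofReal_atTop.comp ((tendsto_rpow_atTop hδ).const_mul_atTop hc)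
  refine le_antisymm le_top (le_of_tendsto hu ?_)
  filter_upwards [Filter.eventually_ge_atTop 0] with z hz
  rw [← powerMeasure_Iic hc.le hδ hz]
  exact measure_mono (subset_univ _)

lemma IsPoissonRandomMeasure.ae_isPointConfiguration
    (H : IsPoissonRandomMeasure P η (powerMeasure c δ)) (hc : 0 < c) (hδ : 0 < δ) :
    ∀ᵐ ω ∂P, IsPointConfiguration (η ω) := by
  have hfin : ∀ᵐ ω ∂P, ∀ k : ℕ, η ω (Iic (k : ℝ)) ≠ ∞ := ae_all_iff.2 fun k =>
    H.ae_ne_top measurableSet_Iic (powerMeasure_Iic_ne_top hc.le hδ _)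
  have hpos : ∀ᵐ ω ∂P, η ω (Iic 0) = 0 := by
    have h1 := H.measure_count_eq (measurableSet_Iic (a := (0 : ℝ)))
      (powerMeasure_Iic_ne_top hc.le hδ _) 0
    rw [powerMeasure_Iic_of_nonpos c δ le_rfl] at h1
    have hms : MeasurableSet {ω | η ω (Iic 0) = 0} :=
      H.measurable_apply measurableSet_Iic (measurableSet_singleton _)
    exact (prob_compl_eq_zero_iff hms).2 (by simpa [poissonWeight] using h1)
  -- Testing with the constant 1 gives mean 0 for exp(-η(ℝ)), because the total intensity is
  -- infinite.
  have hinf : ∀ᵐ ω ∂P, η ω univ = ∞ := by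
    have h1 := H.laplace (fun _ => 1) measurable_const
    simp only [lintegral_const, one_mul] at h1
    have h2 : 1 - expNeg 1 ≠ 0 := by
      rw [Ne, tsub_eq_zero_iff_le, not_le, ← ENNReal.ofReal_one, expNeg_ofReal zero_le_one]
      exact (ENNReal.ofReal_lt_ofReal_iff one_pos).2 (by simp)
    rw [powerMeasure_univ hc hδ, ENNReal.mul_top h2, expNeg_top,
      lintegral_eq_zero_iff (f := fun ω => expNeg (η ω univ)) (measurable_expNeg.comp (H.measurable_apply MeasurableSet.univ))] at h1
    filter_upwards [h1] with ω hω
    by_contra hne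
    exact expNeg_ne_zero hne hω
  filter_upwards [hfin, hpos, hinf] with ω h1 h2 h3
  refine ⟨fun a => ?_, h2, h3, H.integer ω, H.sFinite ω⟩
  obtain ⟨k, hk⟩ := exists_nat_ge a
  exact ((measure_mono (Iic_subset_Iic.2 hk)).trans_lt (h1 k).lt_top).ne

lemma IsPoissonRandomMeasure.aemeasurable_nthPoint
    (H : IsPoissonRandomMeasure P η (powerMeasure c δ)) (hc : 0 < c) (hδ : 0 < δ) {n : ℕ}
    (hn : 1 ≤ n) : AEMeasurable (fun ω => nthPoint (η ω) n) P := by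
  have hconf := H.ae_isPointConfiguration hc hδ
  have h1 : ∀ t : ℝ, NullMeasurableSet {ω | nthPoint (η ω) n ≤ t} P := by
    intro t
    have hms : MeasurableSet {ω | (n : ℝ≥0∞) ≤ η ω (Iic t)} :=
      measurableSet_le measurable_const (H.measurable_apply measurableSet_Iic)
    refine hms.nullMeasurableSet.congr ?_
    filter_upwards [hconf] with ω hω
    exact propext (hω.nthPoint_le_iff hn t).symm
  have h2 : NullMeasurable (fun ω => nthPoint (η ω) n) P :=
    measurable_of_Iic (δ := NullMeasurableSpace Ω P) h1
  exact h2.aemeasurable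

/-- Survival functions are compared: the (m+1)-st point exceeds t iff at most m points lie in (-∞,
t], a disjoint union of events with Poisson probabilities. -/
theorem IsPoissonRandomMeasure.map_nthPoint
    (H : IsPoissonRandomMeasure P η (powerMeasure c δ)) (hc : 0 < c) (hδ : 0 < δ) (m : ℕ) :
    P.map (fun ω => nthPoint (η ω) (m + 1)) = nthPointLaw c δ m := by
  have hconf := H.ae_isPointConfiguration hc hδ
  have hZ := H.aemeasurable_nthPoint hc hδ (show 1 ≤ m + 1 by omega)
  have := isProbabilityMeasure_nthPointLaw hc hδ m
  have := Measure.isProbabilityMeasure_map (μ := P) hZ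
  have hIoi : ∀ t : ℝ, 0 ≤ t →
      P.map (fun ω => nthPoint (η ω) (m + 1)) (Ioi t) = nthPointLaw c δ m (Ioi t) := by
    intro t ht
    have hms : ∀ k : ℕ, MeasurableSet {ω | η ω (Iic t) = k} := fun k =>
      H.measurable_apply measurableSet_Iic (measurableSet_singleton _)
    rw [Measure.map_apply_of_aemeasurable hZ measurableSet_Ioi, nthPointLaw_Ioi hc hδ m ht]
    have h1 : P ((fun ω => nthPoint (η ω) (m + 1)) ⁻¹' Ioi t) =
        P (⋃ k ∈ Finset.range (m + 1), {ω | η ω (Iic t) = k}) := by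
      refine measure_congr (Filter.eventuallyEq_set.2 ?_)
      filter_upwards [hconf] with ω hω
      refine Iff.trans (a := t < nthPoint (η ω) (m + 1)) not_le.symm ?_
      rw [hω.nthPoint_le_iff (by omega), not_le]
      have h2 : ω ∈ (⋃ k ∈ Finset.range (m + 1), {ω | η ω (Iic t) = k}) ↔
          ∃ k ∈ Finset.range (m + 1), η ω (Iic t) = k := by
        rw [mem_iUnion₂]; exact ⟨fun ⟨k, hk, h⟩ => ⟨k, hk, h⟩, fun ⟨k, hk, h⟩ => ⟨k, hk, h⟩⟩
      refine Iff.trans ?_ h2.symm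
      constructor
      · intro hlt
        obtain ⟨k, hk⟩ := hω.integer (Iic t) measurableSet_Iic
        rw [hk] at hlt
        induction k using ENat.recTopCoe with
        | top => simp at hlt
        | coe k =>
          rw [ENat.toENNReal_coe] at hlt hk
          exact ⟨k, Finset.mem_range.2 (by exact_mod_cast hlt), hk⟩
      · rintro ⟨k, hk, h⟩
        rw [h]
        exact_mod_cast Finset.mem_range.1 hk
    have hpow : 0 ≤ c * t ^ δ := by positivity
    rw [h1, measure_biUnion_finset _ fun k _ => hms k]
    · simp_rw [H.measure_count_eq measurableSet_Iic (powerMeasure_Iic_ne_top hc.le hδ t)]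
      rw [powerMeasure_Iic hc.le hδ ht, ENNReal.toReal_ofReal hpow,
        ENNReal.ofReal_sum_of_nonneg fun k _ => poissonWeight_nonneg hpow k]
    · intro k _ l _ hkl
      refine disjoint_left.2 fun ω (h1 : η ω (Iic t) = k) (h2 : η ω (Iic t) = l) => hkl ?_
      exact_mod_cast h1.symm.trans h2
  have hIic : ∀ t : ℝ, 0 ≤ t →
      P.map (fun ω => nthPoint (η ω) (m + 1)) (Iic t) = nthPointLaw c δ m (Iic t) := by
    intro t ht
    rw [← compl_Ioi, prob_compl_eq_one_sub measurableSet_Ioi, prob_compl_eq_one_sub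
      measurableSet_Ioi, hIoi t ht]
  refine eq_of_Iic_eq (fun z => measure_ne_top _ _) fun t => ?_
  rcases le_total 0 t with ht | ht
  · exact hIic t ht
  · have h0 : nthPointLaw c δ m (Iic t) = 0 :=
      measure_mono_null (Iic_subset_Iic.2 ht) (nthPointLaw_Iic_zero c δ m)
    rw [h0]
    refine measure_mono_null (Iic_subset_Iic.2 ht) ?_
    rw [hIic 0 le_rfl, nthPointLaw_Iic_zero]

lemma lintegral_one_sub_expNeg_indicator {μ : Measure ℝ} (w : ℝ → ℝ≥0∞) {A : Set ℝ}
    (hA : MeasurableSet A) :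
    ∫⁻ z, (1 - expNeg (A.indicator w z)) ∂μ = ∫⁻ z in A, (1 - expNeg (w z)) ∂μ := by
  rw [← lintegral_indicator hA]
  refine lintegral_congr fun z => ?_
  by_cases hz : z ∈ A <;> simp [hz, expNeg_zero]

/-- For the tail sum I, E[e^{-sI}] ≤ P(I < ∞) because e^{-∞} = 0. The left side is at least e^{-Ds}
and tends to 1 as s decreases to 0. -/
lemma IsPoissonRandomMeasure.ae_lintegral_inv_ne_top
    (H : IsPoissonRandomMeasure P η (powerMeasure c δ)) (hc : 0 < c) (hδ : 0 < δ) (hδ1 : δ < 1)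
    {b : ℝ} (hb : 0 < b) : ∀ᵐ ω ∂P, ∫⁻ z in Ioi b, ENNReal.ofReal (1 / z) ∂(η ω) ≠ ∞ := by
  have hw : Measurable fun z : ℝ => (Ioi b).indicator (fun z => ENNReal.ofReal (1 / z)) z :=
    Measurable.indicator (by fun_prop) measurableSet_Ioi
  have hAm : Measurable fun ω => ∫⁻ z in Ioi b, ENNReal.ofReal (1 / z) ∂(η ω) := by
    simp_rw [← lintegral_indicator measurableSet_Ioi]
    exact H.measurable_lintegral hw
  set S : Set Ω := {ω | ∫⁻ z in Ioi b, ENNReal.ofReal (1 / z) ∂(η ω) ≠ ∞} with hS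
  have hSm : MeasurableSet S := (hAm (measurableSet_singleton ∞)).compl
  -- D collects the constants of `abs_lowerGamma_add_le` at s/b; the powers of s combine as
  -- s^δ·s^{1-δ} = s, so the exponent is bounded linearly in s.
  set D : ℝ := c * δ * ((1 / δ + 1 / (δ * (1 - δ))) * b ^ (δ - 1)) with hD
  have h1 : ∀ s : ℝ, 0 < s → ENNReal.ofReal (Real.exp (-(D * s))) ≤ P S := by
    intro s hs
    have h2 := H.laplace (fun z => (Ioi b).indicator (fun z => ENNReal.ofReal (s / z)) z)
      (Measurable.indicator (by fun_prop) measurableSet_Ioi)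
    obtain ⟨h3, h4⟩ := setLIntegral_one_sub_expNeg hc.le hδ hδ1 hs hb
    rw [lintegral_one_sub_expNeg_indicator _ measurableSet_Ioi, h3,
      expNeg_ofReal (by linarith)] at h2
    have h5 : -(D * s) ≤ - -logLaplace c δ s b := by
      have h6 := abs_lowerGamma_add_le hδ hδ1 (div_pos hs hb)
      have h7 : -logLaplace c δ s b ≤ c * δ * s ^ δ *
          ((1 / δ + 1 / (δ * (1 - δ))) * (s / b) ^ (1 - δ)) := by
        rw [logLaplace_eq hδ hs hb, ← mul_neg]
        exact mul_le_mul_of_nonneg_left ((neg_le_abs _).trans h6) (by positivity)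
      have h8 : s ^ δ * (s / b) ^ (1 - δ) = s * b ^ (δ - 1) := by
        rw [Real.div_rpow hs.le hb.le, show δ - 1 = -(1 - δ) by ring, Real.rpow_neg hb.le,
          mul_div_assoc', ← Real.rpow_add hs, add_sub_cancel, Real.rpow_one, div_eq_mul_inv]
      have h9 : c * δ * s ^ δ * ((1 / δ + 1 / (δ * (1 - δ))) * (s / b) ^ (1 - δ)) = D * s := by
        calc _ = c * δ * (1 / δ + 1 / (δ * (1 - δ))) * (s ^ δ * (s / b) ^ (1 - δ)) := by ring
          _ = _ := by rw [h8, hD]; ring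
      linarith
    refine (ENNReal.ofReal_le_ofReal (Real.exp_le_exp.2 h5)).trans ?_
    rw [← h2, ← lintegral_indicator_one hSm]
    refine lintegral_mono fun ω => ?_
    by_cases hω : ω ∈ S
    · rw [indicator_of_mem hω]
      exact expNeg_le_one _
    · have h10 : ∫⁻ z in Ioi b, ENNReal.ofReal (1 / z) ∂(η ω) = ∞ := not_not.1 hω
      have h11 : ∫⁻ z, (Ioi b).indicator (fun z => ENNReal.ofReal (s / z)) z ∂(η ω) = ∞ := by
        rw [lintegral_indicator measurableSet_Ioi]
        have : ∀ z, ENNReal.ofReal (s / z) = ENNReal.ofReal s * ENNReal.ofReal (1 / z) := fun z => by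
          rw [← ENNReal.ofReal_mul hs.le, mul_one_div]
        simp_rw [this]
        rw [lintegral_const_mul _ (by fun_prop), h10, ENNReal.mul_top (by simpa using hs)]
      rw [h11, expNeg_top]
      exact zero_le
  have h2 : Filter.Tendsto (fun s : ℝ => ENNReal.ofReal (Real.exp (-(D * s))))
      (nhdsWithin 0 (Ioi 0)) (nhds 1) := by
    have hcont : Continuous fun s : ℝ => ENNReal.ofReal (Real.exp (-(D * s))) :=
      ENNReal.continuous_ofReal.comp (by fun_prop)
    have := (hcont.tendsto 0).mono_left (nhdsWithin_le_nhds (s := Ioi 0))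
    simpa using this
  have h3 : (1 : ℝ≥0∞) ≤ P S :=
    le_of_tendsto h2 (eventually_nhdsWithin_of_forall fun s hs => h1 s hs)
  exact (prob_compl_eq_zero_iff hSm).2 (le_antisymm prob_le_one h3)

theorem IsPoissonRandomMeasure.ae_summable_inv_nthPoint
    (H : IsPoissonRandomMeasure P η (powerMeasure c δ)) (hc : 0 < c) (hδ : 0 < δ) (hδ1 : δ < 1)
    (n : ℕ) : ∀ᵐ ω ∂P, Summable fun k : ℕ => (nthPoint (η ω) (n + 1 + k))⁻¹ := by
  filter_upwards [H.ae_isPointConfiguration hc hδ,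
    H.ae_lintegral_inv_ne_top hc hδ hδ1 one_pos] with ω hω h1
  -- The threshold 1 is arbitrary: with m points up to it, the series from index m + 1 converges,
  -- and finitely many terms do not matter.
  obtain ⟨m, hm⟩ := hω.integer (Iic 1) measurableSet_Iic
  induction m using ENat.recTopCoe with
  | top => exact absurd hm (by simpa using hω.finite 1)
  | coe m =>
    rw [ENat.toENNReal_coe] at hm
    rw [← hω.tsum_inv_nthPoint zero_le_one hm] at h1
    have h2 := ENNReal.summable_toReal h1
    have h3 : ∀ k : ℕ, (ENNReal.ofReal (nthPoint (η ω) (m + 1 + k))⁻¹).toReal =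
        (nthPoint (η ω) (k + (m + 1)))⁻¹ := fun k => by
      rw [ENNReal.toReal_ofReal (inv_nonneg.2 (hω.nthPoint_pos (by omega)).le), add_comm]
    simp_rw [h3] at h2
    have h4 := (summable_nat_add_iff (f := fun k => (nthPoint (η ω) k)⁻¹) (m + 1)).1 h2
    have h5 := (summable_nat_add_iff (f := fun k => (nthPoint (η ω) k)⁻¹) (n + 1)).2 h4
    exact h5.congr fun k => by rw [add_comm]

end PoissonPoints

/-! ### Grid approximation of the conditioning on the (m+1)-st point. -/

section LowerBound

/-- The exponent of the Laplace functional of the interference from beyond `z`. -/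
noncomputable def tailExponent (c δ s z : ℝ) : ℝ≥0∞ :=
  ∫⁻ y in Ioi z, (1 - expNeg (ENNReal.ofReal (s / y))) ∂(powerMeasure c δ)

lemma antitone_tailExponent (c δ s : ℝ) : Antitone (tailExponent c δ s) := fun _ _ h =>
  lintegral_mono_set (Ioi_subset_Ioi h)

lemma measurable_expNeg_tailExponent (c δ s : ℝ) :
    Measurable fun z => expNeg (tailExponent c δ s z) :=
  measurable_expNeg.comp (antitone_tailExponent c δ s).measurable

variable {Ω : Type*} [MeasurableSpace Ω] {P : Measure Ω} [IsProbabilityMeasure P]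
  {η : Ω → Measure ℝ} {c δ s : ℝ}

lemma poissonWeight_one_right (u : ℝ) : poissonWeight u 1 = Real.exp (-u) * u := by
  simp [poissonWeight]

/-- Independence over the three pieces up to a, (a, b] and beyond b. The probability of one point in
(a, b] is Δe^{-Δ} with Δ the intensity of the cell; the factor Δ becomes an integral over the cell,
so that the cells can be added up. -/
lemma IsPoissonRandomMeasure.setLIntegral_two_counts
    (H : IsPoissonRandomMeasure P η (powerMeasure c δ)) (hc : 0 < c) (hδ : 0 < δ)
    (s : ℝ) (m : ℕ) {a b : ℝ} (ha : 0 ≤ a) (hab : a ≤ b) :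
    ∫⁻ ω in {ω | η ω (Iic a) = m} ∩ {ω | η ω (Ioc a b) = 1},
      expNeg (∫⁻ z in Ioi b, ENNReal.ofReal (s / z) ∂(η ω)) ∂P =
    ∫⁻ _ in Ioc a b, ENNReal.ofReal (poissonWeight (c * a ^ δ) m) *
      (ENNReal.ofReal (Real.exp (-(c * b ^ δ - c * a ^ δ))) * expNeg (tailExponent c δ s b))
      ∂(powerMeasure c δ) := by
  have hw : Measurable fun z : ℝ => (Ioi b).indicator (fun z => ENNReal.ofReal (s / z)) z :=
    Measurable.indicator (by fun_prop) measurableSet_Ioi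
  have hd : Disjoint (Iic a) (Ioc a b) :=
    disjoint_left.2 fun z (h1 : z ≤ a) h2 => not_lt.2 h1 h2.1
  have hI := powerMeasure_Ioc hc.le hδ ha hab
  have hle : 0 ≤ c * b ^ δ - c * a ^ δ :=
    sub_nonneg.2 (mul_le_mul_of_nonneg_left (Real.rpow_le_rpow ha hab hδ.le) hc.le)
  have h1 := H.setLIntegral_counts (measurableSet_Iic (a := a)) (measurableSet_Ioc (a := a) (b := b))
    hd (powerMeasure_Iic_ne_top hc.le hδ a) (by rw [hI]; simp) hw
    (fun z (hz : z ≤ a) => indicator_of_notMem (fun h => not_lt.2 (hz.trans hab) h) _)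
    (fun z hz => indicator_of_notMem (fun h => not_lt.2 hz.2 h) _) m 1
  simp_rw [lintegral_indicator measurableSet_Ioi] at h1
  rw [lintegral_one_sub_expNeg_indicator _ measurableSet_Ioi, powerMeasure_Iic hc.le hδ ha, hI,
    ENNReal.toReal_ofReal (by positivity), ENNReal.toReal_ofReal hle, poissonWeight_one_right,
    ENNReal.ofReal_mul (Real.exp_pos _).le, Nat.cast_one] at h1
  rw [h1, setLIntegral_const, hI, tailExponent]
  ring

lemma IsPointConfiguration.tsum_inv_nthPoint_of_count {η : Measure ℝ} (H : IsPointConfiguration η)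
    {m : ℕ} {a b : ℝ} (ha : 0 ≤ a) (hab : a ≤ b) (h1 : η (Iic a) = m) (h2 : η (Ioc a b) = 1)
    (hs : 0 ≤ s) :
    ENNReal.ofReal s * ∑' k : ℕ, ENNReal.ofReal (nthPoint η (m + 1 + 1 + k))⁻¹ =
      ∫⁻ z in Ioi b, ENNReal.ofReal (s / z) ∂η := by
  have h3 : η (Iic b) = (m + 1 : ℕ) := by
    rw [← Iic_union_Ioc_eq_Iic hab, measure_union _ measurableSet_Ioc, h1, h2]
    · push_cast; rfl
    · exact disjoint_left.2 fun z (h1 : z ≤ a) h2 => not_lt.2 h1 h2.1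
  rw [H.tsum_inv_nthPoint (ha.trans hab) h3, ← lintegral_const_mul _ (by fun_prop)]
  refine lintegral_congr fun z => ?_
  rw [← ENNReal.ofReal_mul hs, mul_one_div]

/-- The right end point of the cell of the grid `(1 / N) ℕ` that contains `z`. -/
noncomputable def gridCeil (N : ℕ) (z : ℝ) : ℝ := (⌈z * (N + 1)⌉₊ : ℝ) / (N + 1)

/-- Value at `z` of the grid approximation of the conditional Laplace transform. -/
noncomputable def gridApprox (c δ s : ℝ) (m N : ℕ) (z : ℝ) : ℝ≥0∞ :=
  ENNReal.ofReal (poissonWeight (c * (gridCeil N z - 1 / (N + 1)) ^ δ) m *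
    Real.exp (-(c * gridCeil N z ^ δ - c * (gridCeil N z - 1 / (N + 1)) ^ δ))) *
    expNeg (tailExponent c δ s z)

lemma measurable_gridApprox (c δ s : ℝ) (m N : ℕ) : Measurable (gridApprox c δ s m N) := by
  have h1 : Measurable (gridCeil N) := by
    unfold gridCeil
    have : Measurable fun z : ℝ => ⌈z * (N + 1)⌉₊ := Nat.measurable_ceil.comp (by fun_prop)
    exact ((measurable_from_top (f := fun n : ℕ => (n : ℝ))).comp this).div_const _
  refine Measurable.mul (ENNReal.measurable_ofReal.comp (Measurable.mul ?_ (by fun_prop)))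
    (measurable_expNeg_tailExponent c δ s)
  exact (continuous_poissonWeight m).measurable.comp (by fun_prop)

lemma tendsto_gridCeil {z : ℝ} (hz : 0 ≤ z) :
    Filter.Tendsto (fun N => gridCeil N z) Filter.atTop (nhds z) := by
  have h1 : Filter.Tendsto (fun N : ℕ => (N : ℝ) + 1) Filter.atTop Filter.atTop :=
    Filter.tendsto_atTop_add_const_right _ _ tendsto_natCast_atTop_atTop
  exact (tendsto_nat_ceil_mul_div_atTop hz).comp h1

/-- Both ends of the cell containing z tend to z, so the factor e^{-Δ} tends to 1. -/
lemma tendsto_gridApprox (hδ : 0 < δ) (s : ℝ) (m : ℕ) {z : ℝ} (hz : 0 < z) :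
    Filter.Tendsto (fun N => gridApprox c δ s m N z) Filter.atTop
      (nhds (ENNReal.ofReal (poissonWeight (c * z ^ δ) m) * expNeg (tailExponent c δ s z))) := by
  have hb := tendsto_gridCeil hz.le
  have ha : Filter.Tendsto (fun N : ℕ => gridCeil N z - 1 / ((N : ℝ) + 1)) Filter.atTop (nhds z) := by
    simpa using hb.sub tendsto_one_div_add_atTop_nhds_zero_nat
  have hb' := (hb.rpow_const (p := δ) (Or.inr hδ.le)).const_mul c
  have ha' := (ha.rpow_const (p := δ) (Or.inr hδ.le)).const_mul c
  have h1 := (((continuous_poissonWeight m).tendsto _).comp ha').mul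
    ((Real.continuous_exp.tendsto _).comp (hb'.sub ha').neg)
  rw [sub_self, neg_zero, Real.exp_zero, mul_one] at h1
  exact ENNReal.Tendsto.mul_const ((ENNReal.continuous_ofReal.tendsto _).comp h1)
    (Or.inr (expNeg_ne_top _))

/-- The cells of the grid. -/
def gridCell (N j : ℕ) : Set ℝ := Ioc ((j : ℝ) / (N + 1)) (((j + 1 : ℕ) : ℝ) / (N + 1))

lemma gridCeil_of_mem {N j : ℕ} {z : ℝ} (hz : z ∈ gridCell N j) :
    gridCeil N z = ((j + 1 : ℕ) : ℝ) / (N + 1) := by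
  have hN : (0 : ℝ) < N + 1 := by positivity
  have h1 : ⌈z * (N + 1)⌉₊ = j + 1 := by
    rw [Nat.ceil_eq_iff (by omega)]
    exact ⟨by simpa using (div_lt_iff₀ hN).1 hz.1, (le_div_iff₀ hN).1 hz.2⟩
  rw [gridCeil, h1]

lemma mem_iUnion_gridCell {N : ℕ} {z : ℝ} (hz : 0 < z) : z ∈ ⋃ j, gridCell N j := by
  have hN : (0 : ℝ) < N + 1 := by positivity
  have hpos : 0 < ⌈z * (N + 1)⌉₊ := Nat.ceil_pos.2 (by positivity)
  obtain ⟨j, hj⟩ := Nat.exists_eq_succ_of_ne_zero hpos.ne'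
  have h1 := (Nat.ceil_eq_iff (Nat.succ_ne_zero j)).1 hj
  refine mem_iUnion.2 ⟨j, (div_lt_iff₀ hN).2 ?_, (le_div_iff₀ hN).2 h1.2⟩
  simpa using h1.1

/-- Each cell contributes at most the part of the expectation on the event of m points before it and
one point in it. These events are disjoint, so their sum is at most the full expectation;
configurations with several points in the decisive cell are simply dropped. -/
lemma IsPoissonRandomMeasure.lintegral_gridApprox_le
    (H : IsPoissonRandomMeasure P η (powerMeasure c δ)) (hc : 0 < c) (hδ : 0 < δ) (hs : 0 < s)
    (m N : ℕ) :
    ∫⁻ z, gridApprox c δ s m N z ∂(powerMeasure c δ) ≤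
      ∫⁻ ω, expNeg (ENNReal.ofReal s *
        ∑' k : ℕ, ENNReal.ofReal (nthPoint (η ω) (m + 1 + 1 + k))⁻¹) ∂P := by
  set a : ℕ → ℝ := fun j => (j : ℝ) / (N + 1) with ha
  have hN : (0 : ℝ) < N + 1 := by positivity
  have ha0 : ∀ j, 0 ≤ a j := fun j => by simp only [ha]; positivity
  have hamono : Monotone a := fun j l hjl => by
    simp only [ha]
    gcongr
  set E : ℕ → Set Ω := fun j =>
    {ω | η ω (Iic (a j)) = m} ∩ {ω | η ω (Ioc (a j) (a (j + 1))) = 1} with hE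
  have hEm : ∀ j, MeasurableSet (E j) := fun j =>
    (H.measurable_apply measurableSet_Iic (measurableSet_singleton _)).inter
      (H.measurable_apply measurableSet_Ioc (measurableSet_singleton _))
  have hEd : Pairwise (Function.onFun Disjoint E) := by
    -- The event of cell j puts at least m + 1 points up to every later grid point, which excludes
    -- the event of cell l.
    have key : ∀ j l, j < l → ∀ ω, ω ∈ E j → ω ∉ E l := by
      rintro j l hjl ω ⟨h1, h2⟩ ⟨h3, -⟩
      have h1' : η ω (Iic (a j)) = m := h1
      have h2' : η ω (Ioc (a j) (a (j + 1))) = 1 := h2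
      have h3' : η ω (Iic (a l)) = m := h3
      have h4 : η ω (Iic (a j)) + η ω (Ioc (a j) (a (j + 1))) ≤ η ω (Iic (a l)) := by
        have hd : Disjoint (Iic (a j)) (Ioc (a j) (a (j + 1))) :=
          disjoint_left.2 fun z (h1 : z ≤ a j) h2 => not_lt.2 h1 h2.1
        rw [← measure_union hd measurableSet_Ioc, Iic_union_Ioc_eq_Iic (hamono (Nat.le_succ j))]
        exact measure_mono (Iic_subset_Iic.2 (hamono hjl))
      rw [h1', h2', h3'] at h4
      have : m + 1 ≤ m := by exact_mod_cast h4
      omega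
    intro j l hjl
    refine disjoint_left.2 fun ω h1 h2 => ?_
    rcases lt_or_gt_of_ne hjl with h | h
    · exact key j l h ω h1 h2
    · exact key l j h ω h2 h1
  have hcell : ∀ j, ∫⁻ z in gridCell N j, gridApprox c δ s m N z ∂(powerMeasure c δ) ≤
      ∫⁻ ω in E j, expNeg (ENNReal.ofReal s *
        ∑' k : ℕ, ENNReal.ofReal (nthPoint (η ω) (m + 1 + 1 + k))⁻¹) ∂P := by
    intro j
    have haj : a j ≤ a (j + 1) := hamono (Nat.le_succ j)
    have h1 : ∫⁻ ω in E j, expNeg (ENNReal.ofReal s *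
        ∑' k : ℕ, ENNReal.ofReal (nthPoint (η ω) (m + 1 + 1 + k))⁻¹) ∂P =
        ∫⁻ ω in E j, expNeg (∫⁻ z in Ioi (a (j + 1)), ENNReal.ofReal (s / z) ∂(η ω)) ∂P := by
      refine setLIntegral_congr_fun_ae (hEm j) ?_
      filter_upwards [H.ae_isPointConfiguration hc hδ] with ω hω hωE
      rw [hω.tsum_inv_nthPoint_of_count (ha0 j) haj hωE.1 hωE.2 hs.le]
    rw [h1, H.setLIntegral_two_counts hc hδ s m (ha0 j) haj]
    refine setLIntegral_mono' measurableSet_Ioc fun z hz => ?_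
    have h2 : gridCeil N z = a (j + 1) := gridCeil_of_mem hz
    have h3 : gridCeil N z - 1 / (N + 1) = a j := by
      rw [h2]
      simp only [ha]
      push_cast
      ring
    rw [gridApprox, h3, h2, ENNReal.ofReal_mul
      (poissonWeight_nonneg (mul_nonneg hc.le (Real.rpow_nonneg (ha0 j) _)) m), mul_assoc]
    gcongr
    -- The approximation evaluates the tail at z, not at the right end of the cell. This only lowers
    -- the value and makes continuity of the tail exponent unnecessary in the limit.
    exact antitone_expNeg (antitone_tailExponent c δ s hz.2)
  have hcm : ∀ j, MeasurableSet (gridCell N j) := fun j => measurableSet_Ioc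
  have hμ : ∫⁻ z, gridApprox c δ s m N z ∂(powerMeasure c δ) =
      ∫⁻ z in ⋃ j, gridCell N j, gridApprox c δ s m N z ∂(powerMeasure c δ) := by
    rw [Measure.restrict_eq_self_of_ae_mem]
    rw [ae_iff]
    refine measure_mono_null (fun z hz => ?_) (powerMeasure_Iic_of_nonpos c δ le_rfl)
    exact not_lt.1 fun h => hz (mem_iUnion_gridCell h)
  rw [hμ]
  calc _ ≤ ∑' j, ∫⁻ z in gridCell N j, gridApprox c δ s m N z ∂(powerMeasure c δ) :=
        lintegral_iUnion_le _ _
    _ ≤ ∑' j, ∫⁻ ω in E j, expNeg (ENNReal.ofReal s *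
        ∑' k : ℕ, ENNReal.ofReal (nthPoint (η ω) (m + 1 + 1 + k))⁻¹) ∂P :=
        ENNReal.tsum_le_tsum hcell
    _ = ∫⁻ ω in ⋃ j, E j, expNeg (ENNReal.ofReal s *
        ∑' k : ℕ, ENNReal.ofReal (nthPoint (η ω) (m + 1 + 1 + k))⁻¹) ∂P :=
        (lintegral_iUnion hEm hEd _).symm
    _ ≤ _ := setLIntegral_le_lintegral _ _

/-- The Laplace transform of the sum of the inverses of the points after the `(m + 1)`-st one is at
least the mean of its conditional value. -/
theorem IsPoissonRandomMeasure.lintegral_expNeg_tailExponent_le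
    (H : IsPoissonRandomMeasure P η (powerMeasure c δ)) (hc : 0 < c) (hδ : 0 < δ) (hs : 0 < s)
    (m : ℕ) :
    ∫⁻ z, expNeg (tailExponent c δ s z) ∂(nthPointLaw c δ m) ≤
      ∫⁻ ω, expNeg (ENNReal.ofReal s *
        ∑' k : ℕ, ENNReal.ofReal (nthPoint (η ω) (m + 1 + 1 + k))⁻¹) ∂P := by
  rw [nthPointLaw, lintegral_withDensity_eq_lintegral_mul _ (measurable_poissonWeight_rpow c δ m)
    (measurable_expNeg_tailExponent c δ s)]
  calc _ = ∫⁻ z, Filter.liminf (fun N => gridApprox c δ s m N z) Filter.atTop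
        ∂(powerMeasure c δ) := by
        refine lintegral_congr_ae ((ae_pos_powerMeasure c δ).mono fun z hz => ?_)
        exact (tendsto_gridApprox hδ s m hz).liminf_eq.symm
    -- Fatou's lemma suffices, since only a one-sided bound is required.
    _ ≤ Filter.liminf (fun N => ∫⁻ z, gridApprox c δ s m N z ∂(powerMeasure c δ)) Filter.atTop :=
        lintegral_liminf_le fun N => measurable_gridApprox c δ s m N
    _ ≤ _ := by
        refine Filter.liminf_le_of_le (by isBoundedDefault) fun b hb => ?_
        obtain ⟨N, hN⟩ := hb.exists
        exact hN.trans (H.lintegral_gridApprox_le hc hδ hs m N)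

end LowerBound

/-! ### Jensen's inequality and the passage to the interference. -/

section Interference

variable {c δ s : ℝ}

lemma aestronglyMeasurable_logLaplace (hδ : 0 < δ) (hs : 0 < s) (m : ℕ) :
    AEStronglyMeasurable (logLaplace c δ s) (nthPointLaw c δ m) := by
  have hcont : ContinuousOn (logLaplace c δ s) (Ioi 0) := fun z hz =>
    (hasDerivAt_logLaplace hδ hs hz).continuousAt.continuousWithinAt
  have h1 := hcont.aestronglyMeasurable (μ := nthPointLaw c δ m) measurableSet_Ioi
  have h2 : ∀ᵐ z ∂(nthPointLaw c δ m), z ∈ Ioi (0 : ℝ) := ae_pos_nthPointLaw c δ m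
  rwa [Measure.restrict_eq_self_of_ae_mem h2] at h1

lemma integrable_logLaplace (hc : 0 < c) (hδ : 0 < δ) (hδ1 : δ < 1) (hs : 0 < s) (m : ℕ) :
    Integrable (logLaplace c δ s) (nthPointLaw c δ m) := by
  have := isProbabilityMeasure_nthPointLaw hc hδ m
  obtain ⟨M, hM⟩ := abs_logLaplace_sub_le hc.le hδ hδ1 hs
  refine Integrable.mono' ((integrable_const M).add (integral_mul_rpow_nthPointLaw hc hδ m).1)
    (aestronglyMeasurable_logLaplace hδ hs m) ?_
  filter_upwards [ae_pos_nthPointLaw c δ m] with z hz using hM z hz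

/-- The gamma term is the difference of two integrable functions, the conditional exponent and
c·z^δ, up to a nonzero constant. -/
lemma integrable_lowerGamma_nthPointLaw (hc : 0 < c) (hδ : 0 < δ) (hδ1 : δ < 1) (hs : 0 < s)
    (m : ℕ) : Integrable (fun z => lowerGamma (-δ) (s / z)) (nthPointLaw c δ m) := by
  have h1 := ((integrable_logLaplace hc hδ hδ1 hs m).sub
    (integral_mul_rpow_nthPointLaw hc hδ m).1).const_mul (c * δ * s ^ δ)⁻¹
  refine h1.congr (Filter.Eventually.of_forall fun z => ?_)
  have : c * δ * s ^ δ ≠ 0 := by positivity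
  simp only [Pi.sub_apply, logLaplace]
  field_simp
  ring

lemma integral_logLaplace (hc : 0 < c) (hδ : 0 < δ) (hδ1 : δ < 1) (hs : 0 < s) (m : ℕ) :
    ∫ z, logLaplace c δ s z ∂(nthPointLaw c δ m) =
      (m + 1) + c * δ * s ^ δ * ∫ z, lowerGamma (-δ) (s / z) ∂(nthPointLaw c δ m) := by
  obtain ⟨h1, h2⟩ := integral_mul_rpow_nthPointLaw hc hδ m
  unfold logLaplace
  rw [integral_add h1 ((integrable_lowerGamma_nthPointLaw hc hδ hδ1 hs m).const_mul _), h2,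
    integral_const_mul]

/-- Jensen's inequality for the exponential function. -/
lemma exp_integral_le_lintegral_exp {E : Type*} [MeasurableSpace E] {Q : Measure E}
    [IsProbabilityMeasure Q] {f : E → ℝ} (hf : Integrable f Q) :
    ENNReal.ofReal (Real.exp (∫ z, f z ∂Q)) ≤ ∫⁻ z, ENNReal.ofReal (Real.exp (f z)) ∂Q := by
  set μ := ∫ z, f z ∂Q with hμ
  -- This is the tangent line of exp at the mean μ. Its positive part is integrable and still lies
  -- below exp(f), so integrability of exp(f) is not needed.
  have hi : Integrable (fun z => Real.exp μ * (1 + (f z - μ))) Q :=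
    ((integrable_const 1).add (hf.sub (integrable_const μ))).const_mul _
  have h1 : ∫ z, Real.exp μ * (1 + (f z - μ)) ∂Q = Real.exp μ := by
    have h2 : Integrable (fun z => f z - μ) Q := hf.sub (integrable_const μ)
    rw [integral_const_mul, integral_add (integrable_const 1) h2,
      integral_sub hf (integrable_const μ)]
    simp [hμ]
  rw [← h1]
  refine (ENNReal.ofReal_le_ofReal (integral_mono_ae hi hi.pos_part
    (Filter.Eventually.of_forall fun z => le_max_left _ _))).trans ?_
  rw [ofReal_integral_eq_lintegral_ofReal hi.pos_part
    (Filter.Eventually.of_forall fun z => le_max_right _ _)]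
  refine lintegral_mono fun z => ENNReal.ofReal_le_ofReal (max_le ?_ (Real.exp_pos _).le)
  have h2 : Real.exp (f z) = Real.exp μ * Real.exp (f z - μ) := by
    rw [← Real.exp_add]; congr 1; ring
  rw [h2]
  exact mul_le_mul_of_nonneg_left (by linarith [Real.add_one_le_exp (f z - μ)]) (Real.exp_pos _).le

lemma exp_integral_logLaplace_le (hc : 0 < c) (hδ : 0 < δ) (hδ1 : δ < 1) (hs : 0 < s) (m : ℕ) :
    ENNReal.ofReal (Real.exp (∫ z, logLaplace c δ s z ∂(nthPointLaw c δ m))) ≤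
      ∫⁻ z, expNeg (tailExponent c δ s z) ∂(nthPointLaw c δ m) := by
  have := isProbabilityMeasure_nthPointLaw hc hδ m
  refine (exp_integral_le_lintegral_exp (integrable_logLaplace hc hδ hδ1 hs m)).trans_eq ?_
  refine lintegral_congr_ae ((ae_pos_nthPointLaw c δ m).mono fun z hz => ?_)
  obtain ⟨h1, h2⟩ := setLIntegral_one_sub_expNeg hc.le hδ hδ1 hs hz
  simp only
  rw [tailExponent, h1, expNeg_ofReal (by linarith), neg_neg]

variable {Ω : Type*} [MeasurableSpace Ω] {P : Measure Ω} [IsProbabilityMeasure P]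
  {η : Ω → Measure ℝ}

/-- Holds only almost surely: a divergent real series has the default sum 0, whereas its extended
sum is ∞. -/
lemma IsPoissonRandomMeasure.ae_ofReal_exp_tsum
    (H : IsPoissonRandomMeasure P η (powerMeasure c δ)) (hc : 0 < c) (hδ : 0 < δ) (hδ1 : δ < 1)
    (hs : 0 < s) (n : ℕ) : ∀ᵐ ω ∂P,
    ENNReal.ofReal (Real.exp (-s * ∑' k : ℕ, (nthPoint (η ω) (n + 1 + k))⁻¹)) =
      expNeg (ENNReal.ofReal s * ∑' k : ℕ, ENNReal.ofReal (nthPoint (η ω) (n + 1 + k))⁻¹) := by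
  filter_upwards [H.ae_summable_inv_nthPoint hc hδ hδ1 n, H.ae_isPointConfiguration hc hδ]
    with ω h1 h2
  have h3 : ∀ k : ℕ, 0 ≤ (nthPoint (η ω) (n + 1 + k))⁻¹ := fun k =>
    inv_nonneg.2 (h2.nthPoint_pos (by omega)).le
  rw [← ENNReal.ofReal_tsum_of_nonneg h3 h1, ← ENNReal.ofReal_mul hs.le,
    expNeg_ofReal (mul_nonneg hs.le (tsum_nonneg h3)), neg_mul]

/-- Measurability is inherited from the extended-valued version, where countable sums are always
measurable; the variable is bounded by 1. -/
lemma IsPoissonRandomMeasure.integrable_exp_tsum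
    (H : IsPoissonRandomMeasure P η (powerMeasure c δ)) (hc : 0 < c) (hδ : 0 < δ) (hδ1 : δ < 1)
    (hs : 0 < s) (n : ℕ) :
    Integrable (fun ω => Real.exp (-s * ∑' k : ℕ, (nthPoint (η ω) (n + 1 + k))⁻¹)) P := by
  have hm : AEMeasurable (fun ω => (expNeg (ENNReal.ofReal s *
      ∑' k : ℕ, ENNReal.ofReal (nthPoint (η ω) (n + 1 + k))⁻¹)).toReal) P :=
    (measurable_expNeg.comp_aemeasurable ((AEMeasurable.tsum fun k =>
      (H.aemeasurable_nthPoint hc hδ (by omega)).inv.ennreal_ofReal).const_mul _)).ennreal_toReal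
  refine Integrable.congr (Integrable.mono' (integrable_const (1 : ℝ)) hm.aestronglyMeasurable
    (Filter.Eventually.of_forall fun ω => ?_)) ((H.ae_ofReal_exp_tsum hc hδ hδ1 hs n).mono
      fun ω hω => ?_)
  · rw [Real.norm_of_nonneg ENNReal.toReal_nonneg]
    exact ENNReal.toReal_le_of_le_ofReal zero_le_one (by simpa using expNeg_le_one _)
  · simp only
    rw [← hω, ENNReal.toReal_ofReal (Real.exp_pos _).le]

theorem IsPoissonRandomMeasure.exp_le_integral_exp_tsum
    (H : IsPoissonRandomMeasure P η (powerMeasure c δ)) (hc : 0 < c) (hδ : 0 < δ) (hδ1 : δ < 1)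
    (hs : 0 < s) (m : ℕ) :
    Real.exp (∫ z, logLaplace c δ s z ∂(nthPointLaw c δ m)) ≤
      ∫ ω, Real.exp (-s * ∑' k : ℕ, (nthPoint (η ω) (m + 1 + 1 + k))⁻¹) ∂P := by
  rw [← ENNReal.ofReal_le_ofReal_iff (integral_nonneg fun ω => (Real.exp_pos _).le),
    ofReal_integral_eq_lintegral_ofReal (H.integrable_exp_tsum hc hδ hδ1 hs (m + 1))
      (Filter.Eventually.of_forall fun ω => (Real.exp_pos _).le),
    lintegral_congr_ae (H.ae_ofReal_exp_tsum hc hδ hδ1 hs (m + 1))]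
  exact (exp_integral_logLaplace_le hc hδ hδ1 hs m).trans
    (H.lintegral_expNeg_tailExponent_le hc hδ hs m)

lemma nthInvPower_eq_nthPoint {Ω : Type*} (α φ : ℝ) (x : Plane) (X : ℕ → Ω → Plane)
    (h : ℕ → Ω → ℝ) (n : ℕ) (ω : Ω) :
    nthInvPower α φ x X h n ω = nthPoint (invPowerMeasure α φ x X h ω) n := by
  rw [nthInvPower, nthPoint]
  congr 1
  ext t
  simp only [mem_ofPred_eq]
  rw [invPowerMeasure_apply _ _ _ _ _ _ measurableSet_Iic, ← ENat.toENNReal_coe,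
    ENat.toENNReal_le]
  rfl

lemma gainMoment_pos {α : ℝ} {ν : Measure ℝ} [IsProbabilityMeasure ν]
    (hν_pos : ∀ᵐ t ∂ν, 0 < t) (hν_int : Integrable (fun t : ℝ => t ^ (2 / α)) ν) :
    0 < gainMoment α ν := by
  have h1 : 0 ≤ᵐ[ν] fun t : ℝ => t ^ (2 / α) :=
    hν_pos.mono fun t ht => (Real.rpow_pos_of_pos ht _).le
  rw [gainMoment, integral_pos_iff_support_of_nonneg_ae h1 hν_int]
  have h2 : (Function.support fun t : ℝ => t ^ (2 / α)) =ᵐ[ν] univ :=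
    Filter.eventuallyEq_univ.2 (hν_pos.mono fun t ht => (Real.rpow_pos_of_pos ht _).ne')
  rw [measure_congr h2, measure_univ]
  exact one_pos

lemma integral_nthPointLaw {c δ : ℝ} (hc : 0 ≤ c) (hδ : 0 ≤ δ) (m : ℕ) (f : ℝ → ℝ) :
    ∫ z, f z ∂(nthPointLaw c δ m) =
      ∫ z in Ioi 0, f z * (c * δ * z ^ (δ - 1) * poissonWeight (c * z ^ δ) m) := by
  rw [nthPointLaw, integral_withDensity_eq_integral_toReal_smul
    (measurable_poissonWeight_rpow c δ m) (Filter.Eventually.of_forall fun z => by simp),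
    powerMeasure, integral_withDensity_eq_integral_toReal_smul
    (measurable_powerDensity c δ) (Filter.Eventually.of_forall fun z => by simp)]
  refine setIntegral_congr_fun measurableSet_Ioi fun z hz => ?_
  have hz0 : 0 < z := hz
  simp only [smul_eq_mul]
  rw [ENNReal.toReal_ofReal (by positivity), ENNReal.toReal_ofReal
    (poissonWeight_nonneg (by positivity) m)]
  ring

lemma invPowerPDF_eq {lam α φ : ℝ} {ν : Measure ℝ} (m : ℕ) {z : ℝ} (hz : 0 < z) :
    invPowerPDF lam α φ ν (m + 1) z =
      1 / 2 * gainMoment α ν * φ * lam * (2 / α) * z ^ (2 / α - 1) *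
        poissonWeight (1 / 2 * gainMoment α ν * φ * lam * z ^ (2 / α)) m := by
  rw [invPowerPDF, poissonWeight, Real.rpow_sub_one hz.ne', Nat.add_sub_cancel, pow_succ]
  field_simp

end Interference

theorem mainTheorem7 {Ω : Type*} [MeasurableSpace Ω] (P : Measure Ω) [IsProbabilityMeasure P]
    (lam α φ : ℝ) (hlam : 0 < lam) (hα : 2 < α) (hφ0 : 0 < φ) (hφ : φ ≤ 2 * Real.pi)
    (ν : Measure ℝ) (hν_pos : ∀ᵐ t ∂ν, 0 < t)
    (hν_int : Integrable (fun t : ℝ => t ^ (2 / α)) ν)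
    (X : ℕ → Ω → Plane) (h : ℕ → Ω → ℝ) (hnet : IsPoissonNetwork P lam ν X h)
    (x : Plane) (n : ℕ) (hn : 1 ≤ n) (s : ℝ) (hs : 0 < s) :
    -- the series defining the partial accumulative interference converges almost surely
    (∀ᵐ ω ∂P, Summable fun k : ℕ => (nthInvPower α φ x X h (n + 1 + k) ω)⁻¹) ∧
    -- the Laplace transform is the expectation of an integrable variable
    Integrable (fun ω => Real.exp (-s * partialInterference α φ x X h n ω)) P ∧
    -- the expectation in the bound exists, and is the integral against the density
    Integrable (fun ω => lowerGamma (-2 / α) (s / nthInvPower α φ x X h n ω)) P ∧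
    (∫ ω, lowerGamma (-2 / α) (s / nthInvPower α φ x X h n ω) ∂P =
      ∫ z in Ioi (0 : ℝ), lowerGamma (-2 / α) (s / z) * invPowerPDF lam α φ ν n z) ∧
    -- the lower bound
    Real.exp (n + φ * lam * gainMoment α ν * s ^ (2 / α) / α *
        ∫ ω, lowerGamma (-2 / α) (s / nthInvPower α φ x X h n ω) ∂P) ≤
      ∫ ω, Real.exp (-s * partialInterference α φ x X h n ω) ∂P := by
  -- The n-th point has a density with Poisson weight n - 1, so everything is indexed by m = n - 1.
  obtain ⟨m, rfl⟩ : ∃ m, n = m + 1 := ⟨n - 1, by omega⟩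
  have hνp : IsProbabilityMeasure ν := (hnet.gain_law 0).isProbabilityMeasure_iff.1 inferInstance
  have hα0 : 0 < α := by linarith
  have hδ : 0 < 2 / α := by positivity
  have hδ1 : 2 / α < 1 := by rw [div_lt_one hα0]; exact hα
  have hg := gainMoment_pos hν_pos hν_int
  set c : ℝ := 1 / 2 * gainMoment α ν * φ * lam with hcdef
  have hc : 0 < c := by positivity
  have H := hnet.isPoissonRandomMeasure α φ x
  rw [map_markInvPower_eq hlam hα hφ0 hφ hν_pos hν_int x, ← hcdef] at H
  have hneg : -2 / α = -(2 / α) := neg_div _ _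
  have hZ := H.aemeasurable_nthPoint hc hδ (show 1 ≤ m + 1 by omega)
  have hlaw := H.map_nthPoint hc hδ m
  have hγi := integrable_lowerGamma_nthPointLaw hc hδ hδ1 hs m
  have hγ : ∫ ω, lowerGamma (-(2 / α)) (s / nthPoint (invPowerMeasure α φ x X h ω) (m + 1)) ∂P =
      ∫ z, lowerGamma (-(2 / α)) (s / z) ∂(nthPointLaw c (2 / α) m) := by
    rw [← hlaw] at hγi ⊢
    exact (integral_map hZ hγi.aestronglyMeasurable).symm
  simp only [partialInterference, nthInvPower_eq_nthPoint, hneg]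
  refine ⟨H.ae_summable_inv_nthPoint hc hδ hδ1 (m + 1), H.integrable_exp_tsum hc hδ hδ1 hs (m + 1),
    ?_, ?_, ?_⟩
  · rw [← hlaw] at hγi
    exact hγi.comp_aemeasurable hZ
  · rw [hγ, integral_nthPointLaw hc.le hδ.le]
    refine setIntegral_congr_fun measurableSet_Ioi fun z hz => ?_
    rw [invPowerPDF_eq m hz]
  · rw [hγ]
    -- The exponents agree because c·δ = φ·λ·E[h^δ]/α and m + 1 = n.
    convert! H.exp_le_integral_exp_tsum hc hδ hδ1 hs m using 2
    rw [integral_logLaplace hc hδ hδ1 hs m, hcdef]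
    push_cast
    ring
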